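/- Let $K$ be a number field of degree $d$ with ring of integers $R$, class number $h$, discriminant $D$ and $r_2$ pairs of complex conjugate embeddings, and let $\zeta_K(s)=\sum_{I\neq 0}N(I)^{-s}$ ($\operatorname{Re}s>1$), the sum being over the nonzero ideals of $R$ and absolutely convergent. Identify $K\otimes_{\mathbb Q}\mathbb R$ with $\mathbb R^{r_1}\times\mathbb C^{r_2}$ and let $\mu$ be its Lebesgue (Haar) measure. Let $N$ be the modulus of the norm on $(K\otimes\mathbb R)^*$, $(K\otimes\mathbb R)^*_1=\{N=1\}$, and let $U\subset (K\otimes\mathbb R)^*_1$ be the image of $R^*$. For $A\subset (K\otimes\mathbb R)^*_1$ put $\nu(A)=\mu\{x\in (K\otimes\mathbb R)^*: N(x)\le 1,\ x\,N(x)^{-1/d}\in A\}$. (1) Class number formula. $\nu$ is a Haar measure on $(K\otimes\mathbb R)^*_1$; $U$ has a fundamental domain in $(K\otimes\mathbb R)^*_1$ for $\nu$, and one in $\{x\in(K\otimes\mathbb R)^*:N(x)\le 1\}$ for $\mu$; $\nu((K\otimes\mathbb R)^*_1/U)$ is finite and equals $\mu(\{x\in(K\otimes\mathbb R)^*:N(x)\le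 1\}/U)$; and, for $s\to1$ along real $s>1$, $$\lim_{s\to1^+}(s-1)\zeta_K(s)=h\cdot\frac{\nu((K\otimes\mathbb R)^*_1/U)}{\mu(K\otimes\mathbb R/R)},\qquad \mu(K\otimes\mathbb R/R)=\frac{1}{2^{r_2}}\sqrt{|D|}.$$ (2) Suppose $K/\mathbb Q$ is abelian. For a character $\chi:\mathrm{Gal}(K/\mathbb Q)\to\mathbb C^*$ and a prime $p$ put $\chi(p)=\chi(\mathrm{Frob}_p)$ if $p$ is unramified in $K$ and $\chi(p)=0$ if $p$ ramifies in $K$; extend $\chi$ completely multiplicatively to the positive integers and let $L(s,\chi)=\sum_{n\ge1}\chi(n)n^{-s}$. Then only finitely many primes ramify in $K$, there are only finitely many $\chi$, and for $\operatorname{Re}s>1$ the series $L(s,\chi)$ converge absolutely and $$\zeta_K(s)=F(s)\prod_\chi L(s,\chi),\qquad F(s)=\prod_{p\ \text{ramified in }K}\frac1{(1-p^{-f_ps})^{g_p}},$$ where $f_p$ is the residue degree at $p$ and $g_p$ the number of primes of $K$ above $p$. (3) Let $\chi$ be either a nontrivial character as in (2) and $m\ge1$ a conductor of it, i.e. $\chi(n)$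 depends only on $n$ modulo $m$ and $\chi(p)=0$ for all primes $p\mid m$, or any nontrivial Dirichlet character modulo $m$. Let $\omega$ be a primitive $m$-th root of unity in $\mathbb C$ and $\tau_i(\chi)=\sum_{x\in(\mathbb Z/m\mathbb Z)^*}\chi(x)\omega^{ix}$. Then, with the principal logarithm, the series $L(1,\chi)=\sum_{n\ge1}\chi(n)/n$ converges, it is also the limit of $L(s,\chi)$ as $s\to1$ in $\operatorname{Re}s>1$, and $$L(1,\chi)=-\frac1m\sum_{i=1}^{m-1}\tau_i(\chi)\log(1-\omega^{-i}).$$ -/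

import Mathlib

open NumberField NumberField.mixedEmbedding NumberField.InfinitePlace MeasureTheory Filter Topology
open scoped TensorProduct

noncomputable section

namespace ClassNumberFormula

section General

variable (K : Type*) [Field K] [NumberField K]

/-- The canonical homomorphism of `ℝ`-algebras from `ℝ ⊗ K` to Mathlib's mixed space
`ℝ ^ r₁ × ℂ ^ r₂`, sending `t ⊗ x` to `t • (x at the infinite places)`. -/
def tensorToMixed : ℝ ⊗[ℚ] K →ₐ[ℝ] mixedSpace K :=
  Algebra.TensorProduct.lift (Algebra.ofId ℝ (mixedSpace K)) (mixedEmbedding K).toRatAlgHom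
    (fun _ _ => Commute.all _ _)

/-- The mixed space is canonically `K ⊗ ℝ`. -/
theorem tensorToMixed_bijective : Function.Bijective (tensorToMixed K) := by
  have hs : Function.Surjective (tensorToMixed K).toLinearMap := by
    rw [← LinearMap.range_eq_top, eq_top_iff, ← (latticeBasis K).span_eq, Submodule.span_le]
    rintro _ ⟨i, rfl⟩
    refine ⟨1 ⊗ₜ integralBasis K i, ?_⟩
    rw [latticeBasis_apply]
    simp only [tensorToMixed, AlgHom.toLinearMap_apply, Algebra.TensorProduct.lift_tmul, map_one,
      one_mul, RingHom.toRatAlgHom_apply]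
  have hd : Module.finrank ℝ (ℝ ⊗[ℚ] K) = Module.finrank ℝ (mixedSpace K) := by
    rw [Module.finrank_baseChange, mixedEmbedding.finrank]
  exact ⟨(LinearMap.injective_iff_surjective_of_finrank_eq_finrank hd).mpr hs, hs⟩

/-- The modulus of the norm on the unit group `(K ⊗ ℝ)ˣ`, as a homomorphism to `ℝˣ`. -/
def unitNorm : (mixedSpace K)ˣ →* ℝˣ :=
  Units.map (mixedEmbedding.norm (K := K) : mixedSpace K →* ℝ)

/-- The kernel `(K ⊗ ℝ)ˣ₁` of the modulus of the norm. -/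
def normOneGroup : Subgroup (mixedSpace K)ˣ := (unitNorm K).ker

/-- The image `U` of the units of the ring of integers in `(K ⊗ ℝ)ˣ`. -/
def unitsImage : Subgroup (mixedSpace K)ˣ :=
  (Units.map (((mixedEmbedding K).comp (algebraMap (𝓞 K) K) : 𝓞 K →+* mixedSpace K) :
    𝓞 K →* mixedSpace K)).range

/-- `U` as a subgroup of `(K ⊗ ℝ)ˣ₁` (all of `U` lies in `(K ⊗ ℝ)ˣ₁`). -/
def unitsImageOne : Subgroup (normOneGroup K) := (unitsImage K).subgroupOf (normOneGroup K)

theorem unitsImage_le_normOneGroup : unitsImage K ≤ normOneGroup K := by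
  rintro _ ⟨u, rfl⟩
  exact Units.ext (norm_unit u)

open scoped Classical in
/-- The additive Haar (Lebesgue) measure `μ` of `K ⊗ ℝ`, restricted to the units `(K ⊗ ℝ)ˣ`. -/
def unitsMeasure : Measure (mixedSpace K)ˣ :=
  (volume : Measure (mixedSpace K)).comap Units.val

open scoped Classical in
/-- The volume `μ(K ⊗ ℝ / 𝓞 K)` of `K ⊗ ℝ` modulo the lattice of integers of `K`. -/
def integersCovolume : ℝ :=
  ZLattice.covolume (mixedEmbedding.integerLattice K) (volume : Measure (mixedSpace K))

/-- The elements of `(K ⊗ ℝ)ˣ` whose norm has modulus at most `1`. -/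
def normLeOneUnits : Set (mixedSpace K)ˣ := {u | mixedEmbedding.norm (u : mixedSpace K) ≤ 1}

variable {K} in
theorem norm_pos_of_unit (u : (mixedSpace K)ˣ) :
    0 < mixedEmbedding.norm (u : mixedSpace K) :=
  lt_of_le_of_ne (mixedEmbedding.norm_nonneg _) (unitNorm K u).ne_zero.symm

/-- The unit of `K ⊗ ℝ` given by the scalar `N(u) ^ (-1 / d)`, where `d = [K : ℚ]`. -/
def radialFactor (u : (mixedSpace K)ˣ) : (mixedSpace K)ˣ :=
  Units.map (algebraMap ℝ (mixedSpace K) : ℝ →* mixedSpace K)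
    (Units.mk0 (mixedEmbedding.norm (u : mixedSpace K) ^ (-(Module.finrank ℚ K : ℝ)⁻¹))
      (Real.rpow_pos_of_pos (norm_pos_of_unit u) _).ne')

theorem mul_radialFactor_mem (u : (mixedSpace K)ˣ) : u * radialFactor K u ∈ normOneGroup K := by
  have hd : (Module.finrank ℚ K : ℝ) ≠ 0 := by
    exact_mod_cast (Module.finrank_pos (R := ℚ) (M := K)).ne'
  have hp := norm_pos_of_unit u
  refine Units.ext ?_
  change mixedEmbedding.norm ((u : mixedSpace K) * algebraMap ℝ (mixedSpace K) _) = 1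
  rw [_root_.map_mul, Algebra.algebraMap_eq_smul_one, mixedEmbedding.norm_smul, map_one, mul_one,
    Units.val_mk0, abs_of_pos (Real.rpow_pos_of_pos hp _), ← Real.rpow_natCast,
    ← Real.rpow_mul hp.le, neg_mul, inv_mul_cancel₀ hd, Real.rpow_neg_one, mul_inv_cancel₀ hp.ne']

/-- The radial projection `u ↦ u * N(u) ^ (-1 / d)` from `(K ⊗ ℝ)ˣ` onto `(K ⊗ ℝ)ˣ₁`. -/
def radialProj (u : (mixedSpace K)ˣ) : normOneGroup K :=
  ⟨u * radialFactor K u, mul_radialFactor_mem K u⟩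

/-- The Haar measure `ν` on `(K ⊗ ℝ)ˣ₁`, normalised by `μ`: the measure of a set `A` is the
`μ`-measure of the cone `{t • a | a ∈ A, 0 < t ≤ 1}`. -/
def normOneMeasure : Measure (normOneGroup K) :=
  ((unitsMeasure K).restrict (normLeOneUnits K)).map (radialProj K)

end General

section Characters

variable (K : Type*) [Field K] [NumberField K]

/-- The rational primes that ramify in `K`. -/
def ramifiedPrimes : Set ℕ :=
  {p | p.Prime ∧ ∃ Q ∈ (Ideal.span {(p : ℤ)}).primesOver (𝓞 K), Q.ramificationIdx ℤ ≠ 1}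

open scoped Classical in
/-- A Frobenius automorphism of `K` over the rational prime `p`: some `σ` such that
`σ x ≡ x ^ p` modulo some prime `Q` above `p` for all integers `x` of `K`. For abelian `K` and `p`
unramified there is exactly one such `σ`. -/
def frob (p : ℕ) : K ≃ₐ[ℚ] K :=
  if h : ∃ σ : K ≃ₐ[ℚ] K, ∃ Q ∈ (Ideal.span {(p : ℤ)}).primesOver (𝓞 K), IsArithFrobAt ℤ σ Q
  then h.choose else 1

/-- The correction factor `F(s)`, a product over the ramified primes `p` of
`(1 - p ^ (-f s)) ^ (-g)`, with `f` the residue degree at `p` and `g` the number of primes of `K`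
above `p`. -/
def correctionFactor (s : ℂ) : ℂ :=
  ∏ᶠ p ∈ ramifiedPrimes K,
    ((1 - (p : ℂ) ^ (-((Ideal.span {(p : ℤ)}).inertiaDegIn (𝓞 K) : ℂ) * s))⁻¹) ^
      ((Ideal.span {(p : ℤ)}).primesOver (𝓞 K)).ncard

variable {K}

open scoped Classical in
/-- The value `χ(p)` at a prime `p`: `χ(Frob_p)`, or `0` if `p` ramifies in `K`. -/
def charPrime (χ : (K ≃ₐ[ℚ] K) →* ℂˣ) (p : ℕ) : ℂ :=
  if p ∈ ramifiedPrimes K then 0 else (χ (frob K p) : ℂ)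

/-- The completely multiplicative extension of `p ↦ χ(p)` to the natural numbers. -/
def charNat (χ : (K ≃ₐ[ℚ] K) →* ℂˣ) (n : ℕ) : ℂ :=
  if n = 0 then 0 else n.factorization.prod fun p k => charPrime χ p ^ k

/-- `m` is a conductor of `χ`: the value `χ(n)` only depends on `n` modulo `m`, and `χ` vanishes
on all primes dividing `m`. -/
def IsConductor (χ : (K ≃ₐ[ℚ] K) →* ℂˣ) (m : ℕ) : Prop :=
  0 < m ∧ (∀ a b : ℕ, 0 < a → 0 < b → a ≡ b [MOD m] → charNat χ a = charNat χ b) ∧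
    ∀ p : ℕ, p.Prime → p ∣ m → charNat χ p = 0

end Characters

/-- The Gauss sum `τ_i`, the sum of `a(x) ω ^ (i x)` over the residues `x` prime to `m`. -/
def gaussianSum (m : ℕ) (a : ℕ → ℂ) (ω : ℂ) (i : ℕ) : ℂ :=
  ∑ x ∈ (Finset.Icc 1 m).filter (fun x => x.Coprime m), a x * ω ^ (i * x)

/-- `ℓ` is the value at `s = 1` of the L-series `∑ a(n) / n ^ s`: the series converges to `ℓ` at
`s = 1`, and its values at `s` tend to `ℓ` as `s → 1` in the half-plane `Re s > 1`. -/
def IsLValueAtOne (a : ℕ → ℂ) (ℓ : ℂ) : Prop :=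
  Tendsto (fun N : ℕ => ∑ n ∈ Finset.Icc 1 N, a n / n) atTop (𝓝 ℓ) ∧
    Tendsto (LSeries a) (𝓝[{s : ℂ | 1 < s.re}] 1) (𝓝 ℓ)

end ClassNumberFormula

end

/-! Class number formula. Multiplication by `y` on `K ⊗ ℝ` has determinant of absolute value `N(y)`,
so norm-one elements preserve `μ`, and `ν`, being the `μ`-volume of a cone, is invariant. The
analytic input is Mathlib's residue of `dedekindZeta` and its volume of `normLeOne`, the part of
`fundamentalCone` with `N ≤ 1`. That cone is a domain for the units only modulo the `w` roots of
unity. Intersecting it with a cone over a fundamental domain for the roots of unity gives a strict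
domain for `U` of volume `w` times smaller; as it is stable under positive scaling, it serves both
`μ` and `ν`.

Factorisation. The Euler products are compared prime by prime. At an unramified `p` the order of
Frobenius is `f` and `f * g = |G|` (`orderOf_frob`), and evaluation at an element of order `f`
spreads the characters evenly over the `f`-th roots of unity, so `∏ (1 - χ(σ) T) = (1 - T ^ f) ^ g`
(`prod_one_sub_apply_mul`). At a ramified `p` every L-factor is `1`, which leaves exactly `F(s)`.

Values at 1. For a periodic function of mean zero the partial sums are bounded. Abel summation then
expresses both the series at `1` and the limit of the L-series as one integral, and Fourier
inversion modulo `m` reduces the value to the logarithm series at roots of unity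
(`isLValueAtOne_of_periodic`). Mean zero needs a value `χ(b) ≠ 1` with `b` prime to `m`. For a
Galois character, if almost all Frobenius elements lay in `ker χ`, almost all primes would split
completely in its fixed field `L`; then `ζ_L` would agree with `ζ ^ [L : ℚ]` up to finitely many
factors, and the finite limit of `(s - 1) ζ_L(s)` forces `[L : ℚ] = 1`. -/

namespace ClassNumberFormula

/-! ### Fundamental domains for finite subgroups -/

section FiniteSubgroup

open scoped Pointwise

/-- A finite subgroup of a second countable topological group has a measurable strict
fundamental domain. -/
theorem exists_measurableSet_existsUnique_smul_mem {G : Type*} [Group G] [TopologicalSpace G]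
    [IsTopologicalGroup G] [T1Space G] [SecondCountableTopology G] [MeasurableSpace G]
    [BorelSpace G] (Γ : Subgroup G) [Finite Γ] :
    ∃ S : Set G, MeasurableSet S ∧ ∀ x : G, ∃! g : Γ, g • x ∈ S := by
  have hfin : ((Γ : Set G) \ {1}).Finite := (Set.toFinite (Γ : Set G)).subset Set.sdiff_subset
  have hO : ((Γ : Set G) \ {1})ᶜ ∈ 𝓝 (1 : G) := hfin.isClosed.isOpen_compl.mem_nhds (by simp)
  -- The finite set `Γ \ {1}` is closed, so quotients of nearby points avoid it.
  have hV : ∀ x : G, ∃ V : Set G, IsOpen V ∧ x ∈ V ∧ ∀ g : Γ, ∀ y ∈ V, g • y ∈ V → g = 1 := by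
    intro x
    have hc : Tendsto (fun q : G × G => q.1 * q.2⁻¹) (𝓝 (x, x)) (𝓝 1) := by
      have : Continuous fun q : G × G => q.1 * q.2⁻¹ := by fun_prop
      simpa using this.tendsto (x, x)
    have := hc hO
    rw [mem_map, nhds_prod_eq, Filter.mem_prod_same_iff] at this
    obtain ⟨W, hW, hWO⟩ := this
    refine ⟨interior W, isOpen_interior, mem_interior_iff_mem_nhds.2 hW, fun g y hy hgy => ?_⟩
    have h := hWO (Set.mk_mem_prod (interior_subset hgy) (interior_subset hy))
    by_contra hg
    refine h ⟨?_, ?_⟩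
    · simp [Subgroup.smul_def]
    · simpa [Subgroup.smul_def] using hg
  choose V hVo hVx hVg using hV
  obtain ⟨t, htc, ht⟩ := TopologicalSpace.countable_cover_nhds fun x => (hVo x).mem_nhds (hVx x)
  have htne : t.Nonempty := by
    have : (1 : G) ∈ ⋃ x ∈ t, V x := ht ▸ Set.mem_univ _
    simp only [Set.mem_iUnion] at this
    exact ⟨_, this.choose_spec.choose⟩
  obtain ⟨e, rfl⟩ := htc.exists_eq_range htne
  let O : ℕ → Set G := fun n => ⋃ g : Γ, g • V (e n)
  have hOmem : ∀ n x, x ∈ O n ↔ ∃ g : Γ, g • x ∈ V (e n) := by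
    intro n x
    simp only [O, Set.mem_iUnion, Set.mem_smul_set_iff_inv_smul_mem]
    exact ⟨fun ⟨g, hg⟩ => ⟨g⁻¹, hg⟩, fun ⟨g, hg⟩ => ⟨g⁻¹, by simpa using hg⟩⟩
  have hOinv : ∀ n (g : Γ) x, g • x ∈ O n ↔ x ∈ O n := by
    intro n g x
    simp only [hOmem, smul_smul]
    exact ⟨fun ⟨a, ha⟩ => ⟨a * g, ha⟩, fun ⟨a, ha⟩ => ⟨a * g⁻¹, by simpa using ha⟩⟩
  have hOo : ∀ n, IsOpen (O n) := fun n => isOpen_iUnion fun g => (hVo _).smul g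
  -- Each orbit is represented in the first `V (e n)` it meets, and only there. The saturations `O
  -- k` are invariant, so removing them discards whole orbits; inside one `V (e n)` no two points
  -- share an orbit.
  refine ⟨⋃ n, V (e n) \ ⋃ k < n, O k, MeasurableSet.iUnion fun n => (hVo _).measurableSet.diff
    (MeasurableSet.iUnion fun k => MeasurableSet.iUnion fun _ => (hOo k).measurableSet),
    fun x => ?_⟩
  have hx : ∃ n, x ∈ O n := by
    have : x ∈ ⋃ y ∈ Set.range e, V y := ht ▸ Set.mem_univ _
    simp only [Set.mem_iUnion, Set.mem_range, exists_prop, exists_exists_eq_and] at this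
    obtain ⟨n, hn⟩ := this
    exact ⟨n, (hOmem _ _).2 ⟨1, by simpa using hn⟩⟩
  classical
  have key : ∀ g : Γ, g • x ∈ (⋃ n, V (e n) \ ⋃ k < n, O k) ↔ g • x ∈ V (e (Nat.find hx)) := by
    intro g
    simp only [Set.mem_iUnion, Set.mem_sdiff, not_exists, hOinv]
    constructor
    · rintro ⟨n, hn, hk⟩
      have : n = Nat.find hx := by
        symm
        rw [Nat.find_eq_iff]
        exact ⟨(hOmem _ _).2 ⟨g, hn⟩, fun k hkn => hk k hkn⟩
      exact this ▸ hn
    · intro h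
      exact ⟨_, h, fun k hk => Nat.find_min hx hk⟩
  simp only [key]
  obtain ⟨g, hg⟩ := (hOmem _ _).1 (Nat.find_spec hx)
  refine ⟨g, hg, fun g' hg' => ?_⟩
  have := hVg _ (g' * g⁻¹) _ hg (by simpa [smul_smul] using hg')
  exact mul_inv_eq_one.1 this

end FiniteSubgroup

/-! ### The Haar measure on the norm-one group -/

section Haar

variable (K : Type*) [Field K] [NumberField K]

variable {K} in
-- Multiplication is block diagonal, and a complex factor `z` acts on its real plane with
-- determinant `‖z‖ ^ 2`, which matches the multiplicity of a complex place in the norm.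
theorem abs_det_mulLeft (y : mixedSpace K) :
    |LinearMap.det (LinearMap.mulLeft ℝ y)| = mixedEmbedding.norm y := by
  classical
  have h : LinearMap.mulLeft ℝ y =
      (LinearMap.pi fun w => LinearMap.mulLeft ℝ (y.1 w) ∘ₗ LinearMap.proj w).prodMap
      (LinearMap.pi fun w => LinearMap.mulLeft ℝ (y.2 w) ∘ₗ LinearMap.proj w) := by
    ext <;> simp
  have hc : ∀ z : ℂ, LinearMap.det (LinearMap.mulLeft ℝ z) = ‖z‖ ^ 2 := fun z => by
    rw [← Complex.normSq_eq_norm_sq, ← Algebra.norm_complex_apply]; rfl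
  have hr : ∀ z : ℝ, LinearMap.det (LinearMap.mulLeft ℝ z) = z := fun z => by
    simp
  rw [h, LinearMap.det_prodMap, LinearMap.det_pi, LinearMap.det_pi, mixedEmbedding.norm_apply,
    prod_eq_prod_mul_prod, abs_mul, Finset.abs_prod, Finset.abs_prod]
  congr 1
  · refine Finset.prod_congr rfl fun w _ => ?_
    rw [hr, mult_isReal, pow_one, normAtPlace_apply_of_isReal w.2, Real.norm_eq_abs]
  · refine Finset.prod_congr rfl fun w _ => ?_
    rw [hc, mult_isComplex, normAtPlace_apply_of_isComplex w.2, abs_of_nonneg (by positivity)]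

theorem isOpenEmbedding_unitsVal : IsOpenEmbedding (Units.val : (mixedSpace K)ˣ → mixedSpace K) := by
  classical exact @Units.isOpenEmbedding_val (mixedSpace K) _ _

instance borelSpace_units : BorelSpace (mixedSpace K)ˣ :=
  ⟨by
    rw [(isOpenEmbedding_unitsVal K).isInducing.eq_induced, borel_comap,
      ← BorelSpace.measurable_eq (α := mixedSpace K)]
    rfl⟩

instance secondCountableTopology_units : SecondCountableTopology (mixedSpace K)ˣ :=
  (isOpenEmbedding_unitsVal K).isEmbedding.secondCountableTopology

instance t2Space_units : T2Space (mixedSpace K)ˣ :=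
  (isOpenEmbedding_unitsVal K).isEmbedding.t2Space

theorem measurableEmbedding_unitsVal :
    MeasurableEmbedding (Units.val : (mixedSpace K)ˣ → mixedSpace K) :=
  (isOpenEmbedding_unitsVal K).measurableEmbedding

open scoped Classical in
theorem unitsMeasure_apply (s : Set (mixedSpace K)ˣ) :
    unitsMeasure K s = volume (Units.val '' s) :=
  (measurableEmbedding_unitsVal K).comap_apply _ _

theorem unitsMeasure_preimage_mul {y : (mixedSpace K)ˣ} (hy : y ∈ normOneGroup K)
    (s : Set (mixedSpace K)ˣ) : unitsMeasure K ((y * ·) ⁻¹' s) = unitsMeasure K s := by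
  classical
  have hn : mixedEmbedding.norm (y : mixedSpace K) = 1 := congrArg Units.val hy
  have h : Units.val '' ((y * ·) ⁻¹' s) =
      LinearMap.mulLeft ℝ (y : mixedSpace K) ⁻¹' (Units.val '' s) := by
    ext x
    simp only [Set.mem_image, Set.mem_preimage, LinearMap.mulLeft_apply]
    constructor
    · rintro ⟨u, hu, rfl⟩
      exact ⟨_, hu, rfl⟩
    · rintro ⟨u, hu, h⟩
      exact ⟨y⁻¹ * u, by simpa using hu, by simp [h]⟩
  have hd := abs_det_mulLeft (y : mixedSpace K)
  rw [hn] at hd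
  rw [unitsMeasure_apply, unitsMeasure_apply, h, Measure.addHaar_preimage_linearMap _
    (fun h0 => by simp [h0] at hd), abs_inv, hd]
  simp

theorem continuous_normUnits :
    Continuous fun u : (mixedSpace K)ˣ => mixedEmbedding.norm (u : mixedSpace K) :=
  (mixedEmbedding.continuous_norm K).comp Units.continuous_val

theorem continuous_radialProj : Continuous (radialProj K) := by
  refine Continuous.subtype_mk ?_ _
  rw [(isOpenEmbedding_unitsVal K).isInducing.continuous_iff]
  change Continuous fun u : (mixedSpace K)ˣ => (u : mixedSpace K) *
    algebraMap ℝ (mixedSpace K)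
      (mixedEmbedding.norm (u : mixedSpace K) ^ (-(Module.finrank ℚ K : ℝ)⁻¹))
  refine Units.continuous_val.mul ((continuous_algebraMap ℝ (mixedSpace K)).comp ?_)
  exact (continuous_normUnits K).rpow_const fun u => Or.inl (norm_pos_of_unit u).ne'

variable {K}

theorem norm_val_of_mem {y : (mixedSpace K)ˣ} (hy : y ∈ normOneGroup K) :
    mixedEmbedding.norm (y : mixedSpace K) = 1 := congrArg Units.val hy

theorem norm_mul_of_mem {y : (mixedSpace K)ˣ} (hy : y ∈ normOneGroup K) (u : (mixedSpace K)ˣ) :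
    mixedEmbedding.norm ((y * u : (mixedSpace K)ˣ) : mixedSpace K) =
      mixedEmbedding.norm (u : mixedSpace K) := by
  rw [Units.val_mul, _root_.map_mul, norm_val_of_mem hy, one_mul]

/-- The radial factor depends only on the norm, which `y` does not change. This equivariance
transfers the invariance of `μ` to `ν`. -/
theorem radialProj_mul {y : (mixedSpace K)ˣ} (hy : y ∈ normOneGroup K) (u : (mixedSpace K)ˣ) :
    radialProj K (y * u) = ⟨y, hy⟩ * radialProj K u := by
  have : radialFactor K (y * u) = radialFactor K u := by
    unfold radialFactor
    congr 2
    exact congrArg (· ^ _) (norm_mul_of_mem hy u)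
  refine Subtype.ext ?_
  change y * u * radialFactor K (y * u) = y * (u * radialFactor K u)
  rw [this, mul_assoc]

theorem radialProj_coe (y : normOneGroup K) : radialProj K y = y := by
  refine Subtype.ext (Units.ext ?_)
  change (y.1 : mixedSpace K) * algebraMap ℝ (mixedSpace K) (_ ^ _) = _
  rw [norm_val_of_mem y.2, Real.one_rpow, map_one, mul_one]

variable (K)

theorem normOneMeasure_apply {A : Set (normOneGroup K)} (hA : MeasurableSet A) :
    normOneMeasure K A = unitsMeasure K (radialProj K ⁻¹' A ∩ normLeOneUnits K) := by
  rw [normOneMeasure, Measure.map_apply (continuous_radialProj K).measurable hA,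
    Measure.restrict_apply ((continuous_radialProj K).measurable hA)]

theorem preimage_mul_normLeOneUnits {y : (mixedSpace K)ˣ} (hy : y ∈ normOneGroup K) :
    (y * ·) ⁻¹' (normLeOneUnits K) = normLeOneUnits K := by
  ext u
  simp only [Set.mem_preimage, normLeOneUnits, Set.mem_ofPred_eq, norm_mul_of_mem hy]

theorem map_mul_left_normOneMeasure (y : normOneGroup K) :
    Measure.map (y * ·) (normOneMeasure K) = normOneMeasure K := by
  ext A hA
  rw [Measure.map_apply (measurable_const_mul y) hA, normOneMeasure_apply K hA,
    normOneMeasure_apply K (measurable_const_mul y hA),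
    ← unitsMeasure_preimage_mul K y.2 (radialProj K ⁻¹' A ∩ normLeOneUnits K)]
  congr 1
  rw [Set.preimage_inter, preimage_mul_normLeOneUnits K y.2]
  congr 1
  ext u
  simp only [Set.mem_preimage, radialProj_mul y.2]

theorem isOpenPosMeasure_normOneMeasure : (normOneMeasure K).IsOpenPosMeasure := by
  classical
  refine ⟨fun U hU ⟨a, ha⟩ => ?_⟩
  rw [normOneMeasure_apply K hU.measurableSet]
  set W : Set (mixedSpace K)ˣ := radialProj K ⁻¹' U ∩
    {u | mixedEmbedding.norm (u : mixedSpace K) < 1} with hW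
  have hWo : IsOpen W := (hU.preimage (continuous_radialProj K)).inter
    (isOpen_lt (continuous_normUnits K) continuous_const)
  have hWne : W.Nonempty := by
    have h2 : (2⁻¹ : ℝ) ≠ 0 := by norm_num
    -- Scaling `a` by `1/2` brings it strictly inside the region `N < 1` without changing its radial
    -- projection.
    set c : (mixedSpace K)ˣ := Units.map (algebraMap ℝ (mixedSpace K) : ℝ →* mixedSpace K)
      (Units.mk0 2⁻¹ h2) with hc
    have hcn : mixedEmbedding.norm (c : mixedSpace K) = 2⁻¹ ^ Module.finrank ℚ K := by
      change mixedEmbedding.norm (algebraMap ℝ (mixedSpace K) 2⁻¹) = _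
      rw [Algebra.algebraMap_eq_smul_one, mixedEmbedding.norm_smul, map_one, mul_one,
        abs_of_pos (by norm_num)]
    refine ⟨a * c, ?_, ?_⟩
    · have : radialProj K c = 1 := by
        refine Subtype.ext (Units.ext ?_)
        change algebraMap ℝ (mixedSpace K) 2⁻¹ * algebraMap ℝ (mixedSpace K)
          (mixedEmbedding.norm (c : mixedSpace K) ^ (-(Module.finrank ℚ K : ℝ)⁻¹)) = 1
        rw [hcn, Real.rpow_neg (by positivity), Real.pow_rpow_inv_natCast (by norm_num)
          (Module.finrank_pos).ne', ← _root_.map_mul]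
        norm_num
      rw [Set.mem_preimage, radialProj_mul a.2, this, mul_one]
      exact ha
    · rw [Set.mem_ofPred_eq, norm_mul_of_mem a.2, hcn]
      exact pow_lt_one₀ (by norm_num) (by norm_num) (Module.finrank_pos).ne'
  have hpos : 0 < unitsMeasure K W := by
    rw [unitsMeasure_apply]
    exact (((isOpenEmbedding_unitsVal K).isOpenMap W hWo).measure_pos _ (hWne.image _))
  refine (hpos.trans_le (measure_mono ?_)).ne'
  refine Set.inter_subset_inter_right _ fun u hu => ?_
  rw [Set.mem_ofPred_eq] at hu
  exact hu.le

/-- Since `u = N(u) ^ (1 / d) • radialProj u`, the cone over `C` lies in the compact set `[0, 1] •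
C`. -/
theorem normOneMeasure_lt_top_of_isCompact {C : Set (normOneGroup K)} (hC : IsCompact C) :
    normOneMeasure K C < ⊤ := by
  classical
  have : T2Space (normOneGroup K) := inferInstance
  rw [normOneMeasure_apply K hC.measurableSet, unitsMeasure_apply]
  have hd : (0 : ℝ) < Module.finrank ℚ K := by exact_mod_cast Module.finrank_pos (R := ℚ) (M := K)
  set B : Set (mixedSpace K) := (fun q : ℝ × mixedSpace K => q.1 • q.2) ''
    (Set.Icc 0 1 ×ˢ ((fun y : normOneGroup K => (y.1 : mixedSpace K)) '' C)) with hB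
  have hBc : IsCompact B := by
    refine (isCompact_Icc.prod (hC.image ?_)).image continuous_smul
    exact Units.continuous_val.comp continuous_subtype_val
  refine (measure_mono ?_).trans_lt hBc.measure_lt_top
  rintro _ ⟨u, ⟨hu, hu1⟩, rfl⟩
  have hp := norm_pos_of_unit u
  refine ⟨(mixedEmbedding.norm (u : mixedSpace K) ^ (Module.finrank ℚ K : ℝ)⁻¹,
    ((radialProj K u).1 : mixedSpace K)), ⟨⟨by positivity, ?_⟩, ⟨_, hu, rfl⟩⟩, ?_⟩
  · exact Real.rpow_le_one hp.le hu1 (by positivity)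
  · change _ • ((u : mixedSpace K) * algebraMap ℝ (mixedSpace K) _) = _
    rw [Algebra.algebraMap_eq_smul_one, mul_smul_comm, mul_one, smul_smul, Units.val_mk0,
      ← Real.rpow_add hp, add_neg_cancel, Real.rpow_zero, one_smul]

theorem isHaarMeasure_normOneMeasure : (normOneMeasure K).IsHaarMeasure :=
  { lt_top_of_isCompact := fun _ h => normOneMeasure_lt_top_of_isCompact K h
    map_mul_left_eq_self := map_mul_left_normOneMeasure K
    open_pos := (isOpenPosMeasure_normOneMeasure K).open_pos }

end Haar

/-! ### A fundamental domain for the units, its volume, and the residue -/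

section Covolume

open scoped Pointwise
open NumberField.Units NumberField.mixedEmbedding.fundamentalCone

variable (K : Type*) [Field K] [NumberField K]

theorem smulInvariantMeasure_of_le_normOneGroup {Γ : Subgroup (mixedSpace K)ˣ}
    (h : Γ ≤ normOneGroup K) : SMulInvariantMeasure Γ (mixedSpace K)ˣ (unitsMeasure K) :=
  ⟨fun g s _ => unitsMeasure_preimage_mul K (h g.2) s⟩

theorem smulInvariantMeasure_restrict_of_le_normOneGroup {Γ : Subgroup (mixedSpace K)ˣ}
    (h : Γ ≤ normOneGroup K) :
    SMulInvariantMeasure Γ (mixedSpace K)ˣ ((unitsMeasure K).restrict (normLeOneUnits K)) := by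
  refine ⟨fun g s hs => ?_⟩
  have hg : Measurable fun u : (mixedSpace K)ˣ => g • u := measurable_const_mul (g : (mixedSpace K)ˣ)
  rw [Measure.restrict_apply (hg hs), Measure.restrict_apply hs,
    ← unitsMeasure_preimage_mul K (h g.2) (s ∩ _), Set.preimage_inter,
    preimage_mul_normLeOneUnits K (h g.2)]
  rfl

/-- The embedding of the units of `𝓞 K` into the units of the mixed space. -/
noncomputable def unitsHom : (𝓞 K)ˣ →* (mixedSpace K)ˣ :=
  Units.map (((mixedEmbedding K).comp (algebraMap (𝓞 K) K) : 𝓞 K →+* mixedSpace K) :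
    𝓞 K →* mixedSpace K)

theorem unitsHom_injective : Function.Injective (unitsHom K) :=
  Units.map_injective ((mixedEmbedding_injective K).comp RingOfIntegers.coe_injective)

omit [NumberField K] in
theorem unitsHom_mem (e : (𝓞 K)ˣ) : unitsHom K e ∈ unitsImage K := ⟨e, rfl⟩

/-- The image of the roots of unity of `K` in the units of the mixed space. -/
noncomputable def torsionImage : Subgroup (mixedSpace K)ˣ := (torsion K).map (unitsHom K)

instance finite_torsionImage : Finite (torsionImage K) := by
  have : Finite (torsion K) := inferInstance
  exact Set.Finite.to_subtype ((Set.toFinite (torsion K : Set (𝓞 K)ˣ)).image (unitsHom K))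

theorem card_torsionImage : Nat.card (torsionImage K) = torsionOrder K := by
  rw [torsionOrder, torsionImage]
  exact (Nat.card_congr ((torsion K).equivMapOfInjective _ (unitsHom_injective K)).toEquiv).symm

theorem torsionImage_le_normOneGroup : torsionImage K ≤ normOneGroup K := by
  rintro _ ⟨e, _, rfl⟩
  exact unitsImage_le_normOneGroup K (unitsHom_mem K e)

/-- A measurable strict fundamental domain for the action of the roots of unity. -/
noncomputable def torsionDomain : Set (mixedSpace K)ˣ :=
  (exists_measurableSet_existsUnique_smul_mem (torsionImage K)).choose

theorem measurableSet_torsionDomain : MeasurableSet (torsionDomain K) :=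
  (exists_measurableSet_existsUnique_smul_mem (torsionImage K)).choose_spec.1

theorem existsUnique_smul_mem_torsionDomain (x : (mixedSpace K)ˣ) :
    ∃! g : torsionImage K, g • x ∈ torsionDomain K :=
  (exists_measurableSet_existsUnique_smul_mem (torsionImage K)).choose_spec.2 x

/-- The elements of `(K ⊗ ℝ)ˣ` whose radial projection lies in the fundamental domain for the
roots of unity. -/
def torsionCone : Set (mixedSpace K)ˣ := {u | (radialProj K u : (mixedSpace K)ˣ) ∈ torsionDomain K}

/-- The elements of `(K ⊗ ℝ)ˣ` in the fundamental cone. -/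
def unitsCone : Set (mixedSpace K)ˣ := {u | (u : mixedSpace K) ∈ fundamentalCone K}

/-- A strict fundamental domain for the action of the units of `𝓞 K` on `(K ⊗ ℝ)ˣ`. -/
def unitsDomain : Set (mixedSpace K)ˣ := unitsCone K ∩ torsionCone K

theorem measurableSet_torsionCone : MeasurableSet (torsionCone K) :=
  (measurable_subtype_coe.comp (continuous_radialProj K).measurable) (measurableSet_torsionDomain K)

theorem measurableSet_unitsCone : MeasurableSet (unitsCone K) :=
  Units.continuous_val.measurable (measurableSet_fundamentalCone K)

theorem measurableSet_unitsDomain : MeasurableSet (unitsDomain K) :=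
  (measurableSet_unitsCone K).inter (measurableSet_torsionCone K)

variable {K}

theorem mul_mem_torsionCone_iff {y : (mixedSpace K)ˣ} (hy : y ∈ normOneGroup K)
    (x : (mixedSpace K)ˣ) :
    y * x ∈ torsionCone K ↔ y * (radialProj K x : (mixedSpace K)ˣ) ∈ torsionDomain K := by
  unfold torsionCone
  rw [Set.mem_ofPred_eq, radialProj_mul hy]
  rfl

theorem existsUnique_smul_mem_torsionCone (x : (mixedSpace K)ˣ) :
    ∃! g : torsionImage K, g • x ∈ torsionCone K := by
  refine (existsUnique_congr fun g => ?_).2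
    (existsUnique_smul_mem_torsionDomain K (radialProj K x : (mixedSpace K)ˣ))
  exact mul_mem_torsionCone_iff (torsionImage_le_normOneGroup K g.2) x

theorem torsion_mul_mem_unitsCone {ζ x : (mixedSpace K)ˣ} (hζ : ζ ∈ torsionImage K)
    (hx : x ∈ unitsCone K) : ζ * x ∈ unitsCone K := by
  obtain ⟨e, he, rfl⟩ := hζ
  exact torsion_smul_mem_of_mem hx he

/-- The fundamental cone fixes the unit up to a root of unity, and the torsion cone fixes that root.
The second choice does not disturb the first because roots of unity preserve the fundamental cone.
-/
theorem existsUnique_smul_mem_unitsDomain (x : (mixedSpace K)ˣ) :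
    ∃! g : unitsImage K, g • x ∈ unitsDomain K := by
  obtain ⟨e, he⟩ := exists_unit_smul_mem (norm_pos_of_unit x).ne'
  obtain ⟨⟨ζ, hζ⟩, hζx, hζu⟩ := existsUnique_smul_mem_torsionCone (unitsHom K e * x)
  have hζU : ζ ∈ unitsImage K := by
    obtain ⟨e, _, rfl⟩ := hζ
    exact unitsHom_mem K e
  refine ⟨⟨ζ * unitsHom K e, mul_mem hζU (unitsHom_mem K e)⟩, ⟨?_, ?_⟩, ?_⟩
  · change ζ * unitsHom K e * x ∈ _
    rw [mul_assoc]
    exact torsion_mul_mem_unitsCone hζ he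
  · change ζ * unitsHom K e * x ∈ _
    rw [mul_assoc]
    exact hζx
  · rintro ⟨_, ⟨e', rfl⟩⟩ ⟨h1, h2⟩
    have ht : e' * e⁻¹ ∈ torsion K := by
      refine (unit_smul_mem_iff_mem_torsion he _).1 ?_
      rw [smul_smul, inv_mul_cancel_right]
      exact h1
    have h3 := hζu ⟨unitsHom K (e' * e⁻¹), _, ht, rfl⟩ (by
      change unitsHom K (e' * e⁻¹) * (unitsHom K e * x) ∈ _
      rw [← mul_assoc, ← map_mul, inv_mul_cancel_right]
      exact h2)
    have h4 : unitsHom K (e' * e⁻¹) = ζ := congrArg Subtype.val h3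
    refine Subtype.ext ?_
    change unitsHom K e' = ζ * unitsHom K e
    rw [← h4, ← map_mul, inv_mul_cancel_right]

/-- Both cones are stable under positive scalars. Hence the cone over the norm-one part of the
domain is the domain itself, and the two covolumes agree. -/
theorem radialProj_mem_unitsDomain_iff (x : (mixedSpace K)ˣ) :
    (radialProj K x : (mixedSpace K)ˣ) ∈ unitsDomain K ↔ x ∈ unitsDomain K := by
  unfold unitsDomain
  rw [Set.mem_inter_iff, Set.mem_inter_iff]
  refine and_congr ?_ ?_
  · change (x : mixedSpace K) * algebraMap ℝ (mixedSpace K) _ ∈ fundamentalCone K ↔ _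
    rw [Algebra.algebraMap_eq_smul_one, mul_smul_comm, mul_one,
      fundamentalCone.smul_mem_iff_mem (Units.ne_zero _)]
    rfl
  · unfold torsionCone
    rw [Set.mem_ofPred_eq, Set.mem_ofPred_eq, radialProj_coe]

variable (K)

instance : Countable (unitsImage K) := by
  have : Countable (𝓞 K)ˣ := by
    have : Countable (𝓞 K) := (RingOfIntegers.basis K).equivFun.injective.countable
    exact Function.Injective.countable Units.val_injective
  exact (unitsHom K).rangeRestrict_surjective.countable

instance : Countable (unitsImageOne K) := by
  refine Function.Injective.countable
    (f := fun g : unitsImageOne K => (⟨g.1.1, g.2⟩ : unitsImage K)) fun a b h => ?_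
  have h' : a.1.1 = b.1.1 := congrArg (fun g : unitsImage K => g.1) h
  exact Subtype.ext (Subtype.ext h')

theorem existsUnique_smul_mem_unitsDomain_one (x : normOneGroup K) :
    ∃! g : unitsImageOne K, g • x ∈ (Subtype.val ⁻¹' unitsDomain K : Set (normOneGroup K)) := by
  obtain ⟨g, hg, hu⟩ := existsUnique_smul_mem_unitsDomain (x : (mixedSpace K)ˣ)
  refine ⟨⟨⟨g, unitsImage_le_normOneGroup K g.2⟩, g.2⟩, hg, fun g' hg' => ?_⟩
  have := hu ⟨g'.1.1, g'.2⟩ hg'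
  have h' : g'.1.1 = g.1 := congrArg Subtype.val this
  exact Subtype.ext (Subtype.ext h')

theorem isFundamentalDomain_unitsDomain (μ : Measure (mixedSpace K)ˣ) :
    IsFundamentalDomain (unitsImage K) (unitsDomain K) μ :=
  .mk' (measurableSet_unitsDomain K).nullMeasurableSet existsUnique_smul_mem_unitsDomain

theorem isFundamentalDomain_unitsDomain_one (μ : Measure (normOneGroup K)) :
    IsFundamentalDomain (unitsImageOne K) (Subtype.val ⁻¹' unitsDomain K) μ :=
  .mk' (measurable_subtype_coe (measurableSet_unitsDomain K)).nullMeasurableSet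
    (existsUnique_smul_mem_unitsDomain_one K)

theorem covolume_unitsImage :
    covolume (unitsImage K) (mixedSpace K)ˣ ((unitsMeasure K).restrict (normLeOneUnits K)) =
      unitsMeasure K (unitsDomain K ∩ normLeOneUnits K) := by
  have := smulInvariantMeasure_restrict_of_le_normOneGroup K (unitsImage_le_normOneGroup K)
  rw [(isFundamentalDomain_unitsDomain K _).covolume_eq_volume,
    Measure.restrict_apply (measurableSet_unitsDomain K)]

theorem covolume_unitsImageOne :
    covolume (unitsImageOne K) (normOneGroup K) (normOneMeasure K) =
      unitsMeasure K (unitsDomain K ∩ normLeOneUnits K) := by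
  have := isHaarMeasure_normOneMeasure K
  rw [(isFundamentalDomain_unitsDomain_one K _).covolume_eq_volume,
    normOneMeasure_apply K (measurable_subtype_coe (measurableSet_unitsDomain K))]
  congr 2
  ext x
  exact radialProj_mem_unitsDomain_iff x

variable {K} in
theorem isUnit_of_norm_ne_zero {x : mixedSpace K} (hx : mixedEmbedding.norm x ≠ 0) : IsUnit x := by
  rw [mixedEmbedding.norm_ne_zero_iff] at hx
  rw [Prod.isUnit_iff, Pi.isUnit_iff, Pi.isUnit_iff]
  refine ⟨fun w => ?_, fun w => ?_⟩
  · have := hx w.1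
    rw [normAtPlace_apply_of_isReal w.2] at this
    exact (norm_ne_zero_iff.1 this).isUnit
  · have := hx w.1
    rw [normAtPlace_apply_of_isComplex w.2] at this
    exact (norm_ne_zero_iff.1 this).isUnit

open scoped Classical in
theorem unitsMeasure_unitsCone :
    unitsMeasure K (unitsCone K ∩ normLeOneUnits K) = volume (normLeOne K) := by
  rw [unitsMeasure_apply]
  congr 1
  ext x
  constructor
  · rintro ⟨u, ⟨h1, h2⟩, rfl⟩
    exact ⟨h1, h2⟩
  · rintro ⟨h1, h2⟩
    -- Points of the fundamental cone have nonzero norm, so passing to units loses nothing.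
    obtain ⟨u, rfl⟩ := isUnit_of_norm_ne_zero h1.2
    exact ⟨u, ⟨h1, h2⟩, rfl⟩

open scoped Classical in
-- The truncated fundamental cone is invariant under the roots of unity, so the translates of the
-- torsion cone cut it into `torsionOrder K` pieces of equal volume.
theorem torsionOrder_mul_unitsMeasure :
    torsionOrder K * unitsMeasure K (unitsDomain K ∩ normLeOneUnits K) =
      volume (normLeOne K) := by
  have := smulInvariantMeasure_of_le_normOneGroup K (torsionImage_le_normOneGroup K)
  have hF : IsFundamentalDomain (torsionImage K) (torsionCone K) (unitsMeasure K) :=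
    .mk' (measurableSet_torsionCone K).nullMeasurableSet existsUnique_smul_mem_torsionCone
  have hinv : ∀ g : torsionImage K,
      g • (unitsCone K ∩ normLeOneUnits K) = unitsCone K ∩ normLeOneUnits K := by
    have : ∀ g : torsionImage K,
        g • (unitsCone K ∩ normLeOneUnits K) ⊆ unitsCone K ∩ normLeOneUnits K := by
      rintro g _ ⟨u, ⟨h1, h2⟩, rfl⟩
      refine ⟨torsion_mul_mem_unitsCone g.2 h1, ?_⟩
      change mixedEmbedding.norm ((g.1 * u : (mixedSpace K)ˣ) : mixedSpace K) ≤ 1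
      rw [norm_mul_of_mem (torsionImage_le_normOneGroup K g.2)]
      exact h2
    refine fun g => (this g).antisymm ?_
    rw [Set.subset_smul_set_iff]
    exact this g⁻¹
  rw [← unitsMeasure_unitsCone, hF.measure_eq_tsum (unitsCone K ∩ normLeOneUnits K)]
  simp_rw [hinv]
  have hfin : Fintype (torsionImage K) := Fintype.ofFinite _
  rw [tsum_fintype, Finset.sum_const, nsmul_eq_mul, Finset.card_univ, ← Nat.card_eq_fintype_card,
    card_torsionImage, unitsDomain, Set.inter_right_comm]

theorem unitsMeasure_unitsDomain :
    unitsMeasure K (unitsDomain K ∩ normLeOneUnits K) ≠ ⊤ ∧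
    (unitsMeasure K (unitsDomain K ∩ normLeOneUnits K)).toReal =
      2 ^ nrRealPlaces K * Real.pi ^ nrComplexPlaces K * regulator K / torsionOrder K := by
  classical
  have h := torsionOrder_mul_unitsMeasure K
  rw [fundamentalCone.volume_normLeOne] at h
  have hw : (torsionOrder K : ENNReal) ≠ 0 := by exact_mod_cast (torsionOrder_ne_zero K)
  have ht := congrArg ENNReal.toReal h
  constructor
  · intro h0
    rw [h0, ENNReal.mul_top hw] at h
    exact ENNReal.mul_ne_top (ENNReal.mul_ne_top (by simp) (by simp)) ENNReal.ofReal_ne_top h.symm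
  · have hw' : (torsionOrder K : ℝ) ≠ 0 := by exact_mod_cast (torsionOrder_ne_zero K)
    rw [eq_div_iff hw', mul_comm]
    simpa [ENNReal.toReal_mul, ENNReal.toReal_ofReal (regulator_pos K).le] using ht

theorem integersCovolume_eq : integersCovolume K = 1 / 2 ^ nrComplexPlaces K * √|(discr K : ℝ)| := by
  rw [integersCovolume, covolume_integerLattice]
  simp

/-- The known residue contains `(2π) ^ r₂`: here `π ^ r₂` comes from the volume of the unit domain
and `2 ^ r₂` from the covolume of the integers. -/
theorem classNumberFormula :
    Tendsto (fun s : ℝ => ((s : ℂ) - 1) * dedekindZeta K s) (𝓝[>] 1)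
      (𝓝 (((classNumber K : ℝ) *
        (covolume (unitsImageOne K) (normOneGroup K) (normOneMeasure K)).toReal /
        integersCovolume K : ℝ) : ℂ)) := by
  convert tendsto_sub_one_mul_dedekindZeta_nhdsGT K using 3
  rw [covolume_unitsImageOne, (unitsMeasure_unitsDomain K).2, integersCovolume_eq,
    dedekindZeta_residue_def]
  have h1 : (torsionOrder K : ℝ) ≠ 0 := by exact_mod_cast (torsionOrder_ne_zero K)
  have h2 : √|(discr K : ℝ)| ≠ 0 :=
    (Real.sqrt_pos_of_pos <| abs_pos.mpr (Int.cast_ne_zero.mpr (discr_ne_zero K))).ne'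
  field_simp
  ring

end Covolume

/-! ### The Dedekind zeta function as an ideal sum and an Euler product -/

section DedekindEulerProduct

variable (K : Type*) [Field K] [NumberField K]

theorem isBigO_sum_card_absNorm_eq :
    (fun n : ℕ => ∑ k ∈ Finset.Icc 1 n, (Nat.card {I : Ideal (𝓞 K) // Ideal.absNorm I = k} : ℝ))
      =O[atTop] fun n => (n : ℝ) ^ (1 : ℝ) := by
  simp_rw [Real.rpow_one]
  refine Asymptotics.isBigO_of_div_tendsto_nhds ?_ _ (((Ideal.tendsto_norm_le_div_atTop₀ K).comp
    tendsto_natCast_atTop_atTop).congr fun n => ?_)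
  · filter_upwards [eventually_ne_atTop 0] with n hn h0
    exact absurd (Nat.cast_eq_zero.1 h0) hn
  · simp only [Function.comp_apply, Nat.cast_le, ← Nat.cast_sum, Pi.div_apply]
    congr
    -- The asymptotic count runs over nonzero ideals; the added `1` is the zero ideal, the only one
    -- of norm `0`.
    rw [← add_left_inj 1, ← Ideal.card_norm_le_eq_card_norm_le_add_one,
      show Finset.Icc 1 n = Finset.Ioc 0 n from Finset.Icc_succ_left_eq_Ioc _ _,
      show 1 = Nat.card {I : Ideal (𝓞 K) // Ideal.absNorm I = 0} by
        simp [Ideal.absNorm_eq_zero_iff],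
      Finset.sum_Ioc_add_eq_sum_Icc (n.zero_le),
      ← Finset.card_preimage_eq_sum_card_image_eq
        (fun k _ ↦ Ideal.finite_setOfPred_absNorm_eq k)]
    simp [Set.coe_eq_subtype]

theorem lseriesSummable_card_absNorm_eq {s : ℂ} (hs : 1 < s.re) :
    LSeriesSummable (fun n => (Nat.card {I : Ideal (𝓞 K) // Ideal.absNorm I = n} : ℂ)) s := by
  simpa using LSeriesSummable_of_sum_norm_bigO_and_nonneg (isBigO_sum_card_absNorm_eq K)
    (fun n => Nat.cast_nonneg _) zero_le_one hs

variable {K} in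
theorem tsum_fiber_absNorm {s : ℂ} (hs : s ≠ 0) (n : ℕ) :
    ∑' I : {I : Ideal (𝓞 K) // Ideal.absNorm I = n}, (Ideal.absNorm I.1 : ℂ) ^ (-s) =
      LSeries.term (fun n => (Nat.card {I : Ideal (𝓞 K) // Ideal.absNorm I = n} : ℂ)) s n := by
  have hfin : Finite {I : Ideal (𝓞 K) // Ideal.absNorm I = n} :=
    (Ideal.finite_setOfPred_absNorm_eq n).to_subtype
  have := Fintype.ofFinite {I : Ideal (𝓞 K) // Ideal.absNorm I = n}
  have h : ∀ I : {I : Ideal (𝓞 K) // Ideal.absNorm I = n},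
      (Ideal.absNorm I.1 : ℂ) ^ (-s) = (n : ℂ) ^ (-s) := fun I => by rw [I.2]
  rw [tsum_congr h, tsum_fintype, Finset.sum_const, Finset.card_univ, nsmul_eq_mul,
    ← Nat.card_eq_fintype_card, LSeries.term_def]
  split_ifs with hn
  -- At `n = 0`, `0 ^ (-s) = 0` because `s ≠ 0`, which agrees with the default value of
  -- `LSeries.term`.
  · rw [hn, Nat.cast_zero, Complex.zero_cpow (neg_ne_zero.2 hs), mul_zero]
  · rw [Complex.cpow_neg, div_eq_mul_inv]

omit K [Field K] [NumberField K] in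
theorem summable_of_summable_fiber {α β : Type*} {f : α → ℝ} (hf : ∀ a, 0 ≤ f a) (e : α → β)
    (h1 : ∀ n, Summable fun a : {a // e a = n} => f a)
    (h2 : Summable fun n => ∑' a : {a // e a = n}, f a) : Summable f := by
  rw [← (Equiv.sigmaFiberEquiv e).summable_iff]
  exact (summable_sigma_of_nonneg fun x => hf _).2 ⟨h1, h2⟩

theorem summable_absNorm_cpow {s : ℂ} (hs : 1 < s.re) :
    Summable fun I : Ideal (𝓞 K) => (Ideal.absNorm I : ℂ) ^ (-s) := by
  have hs0 : s ≠ 0 := by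
    rintro rfl
    norm_num at hs
  have hfin : ∀ n, Finite {I : Ideal (𝓞 K) // Ideal.absNorm I = n} :=
    fun n => (Ideal.finite_setOfPred_absNorm_eq n).to_subtype
  refine Summable.of_norm (summable_of_summable_fiber (fun _ => norm_nonneg _)
    (fun I : Ideal (𝓞 K) => Ideal.absNorm I) (fun n => Summable.of_finite) ?_)
  refine (lseriesSummable_card_absNorm_eq K hs).norm.congr fun n => ?_
  have := Fintype.ofFinite {I : Ideal (𝓞 K) // Ideal.absNorm I = n}
  rw [← tsum_fiber_absNorm hs0, tsum_fintype, tsum_fintype]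
  have h : ∀ I : {I : Ideal (𝓞 K) // Ideal.absNorm I = n},
      (Ideal.absNorm I.1 : ℂ) ^ (-s) = (n : ℂ) ^ (-s) := fun I => by rw [I.2]
  simp only [h, Finset.sum_const, nsmul_eq_mul, norm_mul, Complex.norm_natCast]

theorem hasSum_dedekindZeta {s : ℂ} (hs : 1 < s.re) :
    HasSum (fun I : Ideal (𝓞 K) => (Ideal.absNorm I : ℂ) ^ (-s)) (dedekindZeta K s) := by
  have hs0 : s ≠ 0 := by
    rintro rfl
    norm_num at hs
  have h := (summable_absNorm_cpow K hs).hasSum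
  have h2 := h.tsum_fiberwise fun I : Ideal (𝓞 K) => Ideal.absNorm I
  have h3 : dedekindZeta K s = ∑' I : Ideal (𝓞 K), (Ideal.absNorm I : ℂ) ^ (-s) := by
    rw [← h2.tsum_eq, dedekindZeta, LSeries]
    exact tsum_congr fun n => (tsum_fiber_absNorm hs0 n).symm
  rwa [h3]

theorem hasSum_dedekindZeta_ne_bot {s : ℂ} (hs : 1 < s.re) :
    HasSum (fun I : {I : Ideal (𝓞 K) // I ≠ ⊥} => (Ideal.absNorm I.1 : ℂ) ^ (-s))
      (dedekindZeta K s) := by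
  have hs0 : s ≠ 0 := by
    rintro rfl
    norm_num at hs
  refine (hasSum_subtype_iff_of_support_subset
    (s := {I : Ideal (𝓞 K) | I ≠ ⊥}) fun I hI => ?_).2 (hasSum_dedekindZeta K hs)
  rintro rfl
  simp [Complex.zero_cpow (neg_ne_zero.2 hs0)] at hI

variable {K}

/-- Removing the Euler factors at a finite set of primes. -/
theorem dedekindZeta_mul_prod {s : ℂ} (hs : 1 < s.re) (S : Finset (Ideal (𝓞 K)))
    (hS : ∀ P ∈ S, P.IsPrime ∧ P ≠ ⊥) :
    dedekindZeta K s * ∏ P ∈ S, (1 - (Ideal.absNorm P : ℂ) ^ (-s)) =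
      ∑' I : Ideal (𝓞 K), Set.indicator {I | ∀ P ∈ S, ¬ P ∣ I}
        (fun I => (Ideal.absNorm I : ℂ) ^ (-s)) I := by
  classical
  set g : Ideal (𝓞 K) → ℂ := fun I => (Ideal.absNorm I : ℂ) ^ (-s) with hg
  have hgm : ∀ I J, g (I * J) = g I * g J := fun I J => by
    simp only [hg, map_mul, Nat.cast_mul, Complex.natCast_mul_natCast_cpow]
  have hsum := summable_absNorm_cpow K hs
  induction S using Finset.induction_on with
  | empty => simpa using (hasSum_dedekindZeta K hs).tsum_eq.symm
  | insert Q S hQ ih =>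
    have hQp := hS Q (Finset.mem_insert_self _ _)
    have hQprime : Prime Q := Ideal.prime_of_isPrime hQp.2 hQp.1
    specialize ih fun P hP => hS P (Finset.mem_insert_of_mem hP)
    rw [Finset.prod_insert hQ, mul_comm (1 - _), ← mul_assoc, ih, mul_sub, mul_one, ← tsum_mul_right]
    have hinj : Function.Injective fun I : Ideal (𝓞 K) => Q * I := fun I J h =>
      mul_left_cancel₀ hQprime.ne_zero h
    set A : Set (Ideal (𝓞 K)) := {I | ∀ P ∈ S, ¬ P ∣ I} with hA
    have hAQ : ∀ I, Q * I ∈ A ↔ I ∈ A := by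
      intro I
      refine forall₂_congr fun P hP => not_congr ⟨fun h => ?_, fun h => h.mul_left Q⟩
      have hPp := hS P (Finset.mem_insert_of_mem hP)
      have hPprime : Prime P := Ideal.prime_of_isPrime hPp.2 hPp.1
      refine (hPprime.dvd_or_dvd h).resolve_left fun h' => hQ ?_
      have := associated_iff_eq.1 ((hPprime.dvd_prime_iff_associated hQprime).1 h')
      exact this ▸ hP
    -- Sieving: the factor `N(Q) ^ (-s)` moves the sum onto the multiples of `Q` in `A`, because `Q`
    -- is none of the primes already removed. Subtracting leaves the ideals not divisible by `Q`.
    have h1 : ∀ I, A.indicator g I * g Q = ((A ∩ {I | Q ∣ I}).indicator g) (Q * I) := by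
      intro I
      by_cases hI : I ∈ A
      · rw [Set.indicator_of_mem hI, Set.indicator_of_mem
            (show Q * I ∈ A ∩ {I | Q ∣ I} from ⟨(hAQ I).2 hI, dvd_mul_right Q I⟩), hgm,
          mul_comm]
      · rw [Set.indicator_of_notMem hI, Set.indicator_of_notMem (fun h => hI ((hAQ I).1 h.1)),
          zero_mul]
    rw [tsum_congr h1, hinj.tsum_eq (f := (A ∩ {I | Q ∣ I}).indicator g) ?_,
      ← (hsum.indicator _).tsum_sub (hsum.indicator _)]
    · refine tsum_congr fun I => ?_
      by_cases hI : I ∈ A <;> by_cases hQI : Q ∣ I <;>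
        simp only [hA, Set.mem_ofPred_eq] at hI <;>
        simp [Set.indicator_apply, hA, hI, hQI, hg]
    · intro I hI
      obtain ⟨J, hJ⟩ := (Set.mem_of_indicator_ne_zero hI).2
      exact ⟨J, hJ.symm⟩

theorem isMaximal_span_natCast {p : ℕ} (hp : p.Prime) :
    (Ideal.span {(p : ℤ)}).IsMaximal :=
  ((Ideal.span_singleton_prime (by exact_mod_cast hp.ne_zero)).2
    (Nat.prime_iff_prime_int.1 hp)).isMaximal (by simpa using hp.ne_zero)

theorem finite_primesOver_natCast {p : ℕ} (hp : p.Prime) :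
    ((Ideal.span {(p : ℤ)}).primesOver (𝓞 K)).Finite :=
  have := isMaximal_span_natCast hp
  IsDedekindDomain.primesOver_finite _ _

theorem ne_bot_of_mem_primesOver {p : ℕ} (hp : p.Prime) {P : Ideal (𝓞 K)}
    (hP : P ∈ (Ideal.span {(p : ℤ)}).primesOver (𝓞 K)) : P ≠ ⊥ :=
  have := hP.2
  Ideal.ne_bot_of_liesOver_of_ne_bot (p := Ideal.span {(p : ℤ)})
    (by simpa using hp.ne_zero) P

omit [NumberField K] in
theorem natCast_mem_iff_of_mem_primesOver {p : ℕ} {P : Ideal (𝓞 K)}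
    (hP : P ∈ (Ideal.span {(p : ℤ)}).primesOver (𝓞 K)) (n : ℕ) : (n : 𝓞 K) ∈ P ↔ p ∣ n := by
  have h : (n : ℤ) ∈ P.under ℤ ↔ (n : 𝓞 K) ∈ P := by simp [Ideal.under_def, Ideal.mem_comap]
  rw [← h, ← hP.2.over, Ideal.mem_span_singleton, Int.natCast_dvd_natCast]

theorem absNorm_of_mem_primesOver {p : ℕ} (hp : p.Prime) {P : Ideal (𝓞 K)}
    (hP : P ∈ (Ideal.span {(p : ℤ)}).primesOver (𝓞 K)) :
    Ideal.absNorm P = p ^ P.inertiaDeg ℤ := by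
  have := isMaximal_span_natCast hp
  have := hP.1
  have := hP.2
  have : P.IsMaximal := hP.1.isMaximal (ne_bot_of_mem_primesOver hp hP)
  rw [Ideal.absNorm_eq_pow_inertiaDeg' P hp, Ideal.inertiaDeg'_eq_inertiaDeg]

theorem exists_mem_primesOver_of_ne_top {I : Ideal (𝓞 K)} (hI : I ≠ ⊥) (hI' : I ≠ ⊤) :
    ∃ p : ℕ, p.Prime ∧ ∃ P ∈ (Ideal.span {(p : ℤ)}).primesOver (𝓞 K), P ∣ I := by
  obtain ⟨M, hM, hIM⟩ := Ideal.exists_le_maximal I hI'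
  have hM0 : M ≠ ⊥ := fun h => hI (le_bot_iff.1 (h ▸ hIM))
  have hu : (M.under ℤ).IsPrime := inferInstance
  have hu0 : M.under ℤ ≠ ⊥ := by
    intro h
    exact hM0 (Ideal.eq_bot_of_comap_eq_bot (R := ℤ) h)
  obtain ⟨n, hn⟩ : ∃ n : ℤ, M.under ℤ = Ideal.span {n} :=
    ⟨_, (Submodule.IsPrincipal.span_singleton_generator _).symm⟩
  have hn0 : n ≠ 0 := by
    rintro rfl
    exact hu0 (by simpa using hn)
  have hnp : Prime n := (Ideal.span_singleton_prime hn0).1 (hn ▸ hu)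
  refine ⟨n.natAbs, Int.prime_iff_natAbs_prime.1 hnp, M, ⟨hM.isPrime, ⟨?_⟩⟩, Ideal.dvd_iff_le.2 hIM⟩
  rw [hn, Int.span_natAbs]

/-- The primes of `K` above a rational prime `p`, as a finite set. -/
noncomputable def primesAbove (K : Type*) [Field K] [NumberField K] (p : ℕ) :
    Finset (Ideal (𝓞 K)) :=
  open scoped Classical in
  if hp : p.Prime then (finite_primesOver_natCast (K := K) hp).toFinset else ∅

theorem mem_primesAbove {p : ℕ} (hp : p.Prime) {P : Ideal (𝓞 K)} :
    P ∈ primesAbove K p ↔ P ∈ (Ideal.span {(p : ℤ)}).primesOver (𝓞 K) := by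
  simp [primesAbove, hp]

theorem card_primesAbove {p : ℕ} (hp : p.Prime) :
    (primesAbove K p).card = ((Ideal.span {(p : ℤ)}).primesOver (𝓞 K)).ncard := by
  rw [primesAbove, dif_pos hp, Set.ncard_eq_toFinset_card _ (finite_primesOver_natCast hp)]

/-- The Euler product of the Dedekind zeta function, ordered by rational primes. -/
theorem tendsto_dedekindZeta_mul_prod {s : ℂ} (hs : 1 < s.re) :
    Tendsto (fun N : ℕ => dedekindZeta K s * ∏ p ∈ N.primesBelow, ∏ P ∈ primesAbove K p,
      (1 - (p : ℂ) ^ (-(P.inertiaDeg ℤ : ℂ) * s))) atTop (𝓝 1) := by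
  classical
  have hs0 : s ≠ 0 := by
    rintro rfl
    norm_num at hs
  set S : ℕ → Finset (Ideal (𝓞 K)) := fun N => N.primesBelow.biUnion (primesAbove K) with hSdef
  have hS : ∀ N, ∀ P ∈ S N, P.IsPrime ∧ P ≠ ⊥ := by
    intro N P hP
    obtain ⟨p, hp, hPp⟩ := Finset.mem_biUnion.1 hP
    have hp' := Nat.prime_of_mem_primesBelow hp
    rw [mem_primesAbove hp'] at hPp
    exact ⟨hPp.1, ne_bot_of_mem_primesOver hp' hPp⟩
  have hprod : ∀ N, ∏ p ∈ N.primesBelow, ∏ P ∈ primesAbove K p,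
      (1 - (p : ℂ) ^ (-(P.inertiaDeg ℤ : ℂ) * s)) =
      ∏ P ∈ S N, (1 - (Ideal.absNorm P : ℂ) ^ (-s)) := by
    intro N
    rw [hSdef, Finset.prod_biUnion]
    · refine Finset.prod_congr rfl fun p hp => Finset.prod_congr rfl fun P hP => ?_
      have hp' := Nat.prime_of_mem_primesBelow hp
      rw [mem_primesAbove hp'] at hP
      rw [absNorm_of_mem_primesOver hp' hP, Nat.cast_pow, ← Complex.natCast_cpow_natCast_mul,
        mul_neg, neg_mul]
    · intro p hp q hq hpq
      have hp' := Nat.prime_of_mem_primesBelow hp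
      have hq' := Nat.prime_of_mem_primesBelow hq
      refine Finset.disjoint_left.2 fun P hP hP' => hpq ?_
      rw [mem_primesAbove hp'] at hP
      rw [mem_primesAbove hq'] at hP'
      have := (natCast_mem_iff_of_mem_primesOver hP q).1
        ((natCast_mem_iff_of_mem_primesOver hP' q).2 dvd_rfl)
      exact (Nat.prime_dvd_prime_iff_eq hp' hq').1 this
  simp_rw [hprod, dedekindZeta_mul_prod hs _ (hS _)]
  have hlim : ∑' I : Ideal (𝓞 K), (if I = ⊤ then (1 : ℂ) else 0) = 1 := tsum_ite_eq _ _
  rw [← hlim]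
  -- Every nonzero proper ideal has a prime factor and is eventually sieved out, so in the limit
  -- only the unit ideal contributes.
  refine tendsto_tsum_of_dominated_convergence (summable_absNorm_cpow K hs).norm (fun I => ?_)
    (Eventually.of_forall fun N I => norm_indicator_le_norm_self _ _)
  refine tendsto_const_nhds.congr' ?_
  by_cases hI : I = ⊤
  · refine Eventually.of_forall fun N => ?_
    dsimp only
    rw [if_pos hI, Set.indicator_of_mem, hI]
    · simp
    · intro P hP hPI
      rw [hI, ← Ideal.one_eq_top] at hPI
      exact (hS N P hP).1.ne_top (Ideal.isUnit_iff.1 (isUnit_of_dvd_one hPI))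
  · rw [if_neg hI]
    by_cases hI0 : I = ⊥
    · refine Eventually.of_forall fun N => ?_
      symm
      refine Set.indicator_apply_eq_zero.2 fun _ => ?_
      simp [hI0, Complex.zero_cpow (neg_ne_zero.2 hs0)]
    · obtain ⟨p, hp, P, hP, hPI⟩ := exists_mem_primesOver_of_ne_top hI0 hI
      filter_upwards [eventually_gt_atTop p] with N hN
      rw [Set.indicator_of_notMem]
      intro h
      refine h P ?_ hPI
      exact Finset.mem_biUnion.2 ⟨p, Nat.mem_primesBelow.2 ⟨hN, hp⟩, (mem_primesAbove hp).2 hP⟩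

end DedekindEulerProduct

/-! ### Products over the characters of a finite abelian group -/

section CharacterProduct

/-- The product of the reversed characteristic polynomials `1 - χ(σ) T` over all characters `χ`
of a finite abelian group. -/
theorem prod_one_sub_apply_mul {G : Type*} [CommGroup G] [Finite G] [Fintype (G →* ℂˣ)] (σ : G)
    {g : ℕ} (hg : g * orderOf σ = Nat.card G) (T : ℂ) :
    ∏ χ : G →* ℂˣ, (1 - (χ σ : ℂ) * T) = (1 - T ^ orderOf σ) ^ g := by
  classical
  have : NeZero (Monoid.exponent G : ℂ) := ⟨Nat.cast_ne_zero.2 Monoid.exponent_ne_zero_of_finite⟩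
  have hne : NeZero (Monoid.exponent G) := ⟨Monoid.exponent_ne_zero_of_finite⟩
  have hf : 0 < orderOf σ := orderOf_pos σ
  set f := orderOf σ with hfdef
  let E : (G →* ℂˣ) →* ℂˣ := MonoidHom.eval σ
  have hE : ∀ χ, E χ = χ σ := fun _ => rfl
  have hcard : Nat.card (G →* ℂˣ) = Nat.card G :=
    CommGroup.card_monoidHom_of_hasEnoughRootsOfUnity G ℂ
  have hrangefin : Finite E.range := Finite.of_surjective _ E.rangeRestrict_surjective
  have hle : E.range ≤ rootsOfUnity f ℂ := by
    rintro _ ⟨χ, rfl⟩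
    rw [mem_rootsOfUnity, hE, ← map_pow, pow_orderOf_eq_one, map_one]
  have hpos : 0 < Nat.card E.range := Nat.card_pos
  -- The power of `σ` with exponent `|E.range|` is killed by every character, hence trivial, as
  -- characters separate points. So evaluation at `σ` reaches all `f`-th roots of unity.
  have hdvd : f ∣ Nat.card E.range := by
    refine orderOf_dvd_of_pow_eq_one ?_
    by_contra h
    obtain ⟨χ, hχ⟩ := CommGroup.exists_apply_ne_one_of_hasEnoughRootsOfUnity G ℂ h
    refine hχ ?_
    have h1 : (⟨E χ, χ, rfl⟩ : E.range) ^ Nat.card E.range = 1 := pow_card_eq_one'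
    rw [map_pow]
    exact congrArg Subtype.val h1
  have : NeZero f := ⟨hf.ne'⟩
  have hfin2 : Finite (rootsOfUnity f ℂ) := inferInstance
  have hcr : Nat.card (rootsOfUnity f ℂ) = f := Complex.card_rootsOfUnity f
  have hrange : E.range = rootsOfUnity f ℂ := by
    refine Subgroup.eq_of_le_of_card_ge hle ?_
    rw [hcr]
    exact Nat.le_of_dvd hpos hdvd
  have hker : Nat.card E.ker = g := by
    have h1 := E.ker.card_mul_index
    rw [Subgroup.index_ker, hrange, hcr, hcard, ← hg] at h1
    exact Nat.eq_of_mul_eq_mul_right hf h1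
  -- Fibres of evaluation at `σ` are cosets of its kernel, hence all of size `g`.
  have hfib : ∀ z ∈ (Polynomial.nthRootsFinset f (1 : ℂ)),
      (Finset.univ.filter fun χ : G →* ℂˣ => (χ σ : ℂ) = z).card = g := by
    intro z hz
    rw [Polynomial.mem_nthRootsFinset hf] at hz
    have hz0 : z ≠ 0 := by
      rintro rfl
      rw [zero_pow hf.ne'] at hz
      exact zero_ne_one hz
    have hzm : Units.mk0 z hz0 ∈ E.range := by
      rw [hrange, mem_rootsOfUnity]
      exact Units.ext hz
    obtain ⟨χ₀, hχ₀⟩ := hzm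
    have hχ₀' : (χ₀ σ : ℂ) = z := congrArg Units.val hχ₀
    rw [← hker, ← Fintype.card_subtype, ← Nat.card_eq_fintype_card]
    refine Nat.card_congr ⟨fun χ => ⟨χ.1 * χ₀⁻¹, ?_⟩, fun χ => ⟨χ.1 * χ₀, ?_⟩, fun χ => ?_,
      fun χ => ?_⟩
    · have : χ.1 σ = χ₀ σ := Units.ext (χ.2.trans hχ₀'.symm)
      change (χ.1 * χ₀⁻¹) σ = 1
      rw [MonoidHom.mul_apply, MonoidHom.inv_apply, this, mul_inv_cancel]
    · have : χ.1 σ = 1 := χ.2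
      rw [MonoidHom.mul_apply, this, one_mul, hχ₀']
    · exact Subtype.ext (MonoidHom.ext fun x => inv_mul_cancel_right (χ.1 x) (χ₀ x))
    · exact Subtype.ext (MonoidHom.ext fun x => mul_inv_cancel_right (χ.1 x) (χ₀ x))
  have hmaps : ∀ χ ∈ (Finset.univ : Finset (G →* ℂˣ)),
      (χ σ : ℂ) ∈ Polynomial.nthRootsFinset f (1 : ℂ) := by
    intro χ _
    rw [Polynomial.mem_nthRootsFinset hf]
    have : χ σ ∈ rootsOfUnity f ℂ := hle ⟨χ, rfl⟩
    rw [mem_rootsOfUnity] at this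
    simpa using congrArg Units.val this
  rw [← Finset.prod_fiberwise_of_maps_to hmaps]
  have : ∀ z ∈ Polynomial.nthRootsFinset f (1 : ℂ),
      ∏ χ : G →* ℂˣ with (χ σ : ℂ) = z, (1 - (χ σ : ℂ) * T) = (1 - z * T) ^ g := by
    intro z hz
    rw [← hfib z hz]
    refine Finset.prod_eq_pow_card fun χ hχ => ?_
    rw [(Finset.mem_filter.1 hχ).2]
  rw [Finset.prod_congr rfl this, Finset.prod_pow]
  have := (Complex.isPrimitiveRoot_exp f hf.ne').pow_sub_pow_eq_prod_sub_mul 1 T hf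
  rw [one_pow] at this
  rw [this]

end CharacterProduct

/-! ### Frobenius elements and their orders -/

section Frobenius

variable {K : Type*} [Field K] [NumberField K]

/-- A ramified prime divides the discriminant, which is nonzero. -/
theorem finite_ramifiedPrimes : (ramifiedPrimes K).Finite := by
  refine (Finset.finite_toSet (discr K).natAbs.primeFactors).subset ?_
  rintro p ⟨hp, Q, hQ, hne⟩
  have hp' : Prime (p : ℤ) := Nat.prime_iff_prime_int.1 hp
  rw [Finset.mem_coe, Nat.mem_primeFactors]
  refine ⟨hp, ?_, Int.natAbs_ne_zero.2 (discr_ne_zero K)⟩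
  by_contra h
  have h' : ¬ (p : ℤ) ∣ discr K := fun hd => h (Int.natCast_dvd.1 hd)
  rw [not_dvd_discr_iff_isUnramifiedIn K (𝓞 K) hp'] at h'
  have := hQ.1
  exact hne (h'.ramificationIdx_eq_one hQ.2)

/-- For Galois `K` the default branch of `frob` is never taken at a prime. -/
theorem exists_isArithFrobAt_frob [IsGalois ℚ K] {p : ℕ} (hp : p.Prime) :
    ∃ Q ∈ (Ideal.span {(p : ℤ)}).primesOver (𝓞 K), IsArithFrobAt ℤ (frob K p) Q := by
  have h : ∃ σ : K ≃ₐ[ℚ] K, ∃ Q ∈ (Ideal.span {(p : ℤ)}).primesOver (𝓞 K),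
      IsArithFrobAt ℤ σ Q := by
    have := isMaximal_span_natCast hp
    obtain ⟨⟨Q, hQ⟩⟩ : Nonempty ((Ideal.span {(p : ℤ)}).primesOver (𝓞 K)) := inferInstance
    have := hQ.1
    have : Finite (𝓞 K ⧸ Q) :=
      Ring.HasFiniteQuotients.finiteQuotient (ne_bot_of_mem_primesOver hp hQ)
    obtain ⟨σ, hσ⟩ := IsArithFrobAt.exists_of_isInvariant ℤ (K ≃ₐ[ℚ] K) Q
    exact ⟨σ, Q, hQ, hσ⟩
  rw [frob, dif_pos h]
  exact h.choose_spec

omit [NumberField K] in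
theorem card_int_quotient_under {p : ℕ} {Q : Ideal (𝓞 K)}
    (hQ : Q ∈ (Ideal.span {(p : ℤ)}).primesOver (𝓞 K)) : Nat.card (ℤ ⧸ Q.under ℤ) = p := by
  rw [← hQ.2.over]
  simp [Nat.card_congr (Int.quotientSpanNatEquivZMod p).toEquiv]

theorem IsArithFrobAt.pow_smul_sub_mem {p : ℕ} {Q : Ideal (𝓞 K)}
    (hQ : Q ∈ (Ideal.span {(p : ℤ)}).primesOver (𝓞 K)) {σ : K ≃ₐ[ℚ] K}
    (hσ : IsArithFrobAt ℤ σ Q) (k : ℕ) (x : 𝓞 K) : (σ ^ k) • x - x ^ p ^ k ∈ Q := by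
  have h1 : ∀ x : 𝓞 K, σ • x - x ^ p ∈ Q := by
    intro x
    have := hσ x
    rwa [card_int_quotient_under hQ] at this
  induction k generalizing x with
  | zero => simp
  | succ k ih =>
    have h2 := ih (σ • x)
    have h3 : (σ • x) ^ p ^ k - (x ^ p) ^ p ^ k ∈ Q :=
      Ideal.mem_of_dvd _ (sub_dvd_pow_sub_pow _ _ _) (h1 x)
    have := Q.add_mem h2 h3
    rwa [sub_add_sub_cancel, ← mul_smul, ← pow_succ, ← pow_mul, ← pow_succ'] at this

theorem card_quotient_of_mem_primesOver {p : ℕ} (hp : p.Prime) {Q : Ideal (𝓞 K)}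
    (hQ : Q ∈ (Ideal.span {(p : ℤ)}).primesOver (𝓞 K)) :
    Nat.card (𝓞 K ⧸ Q) = p ^ Q.inertiaDeg ℤ := by
  rw [← absNorm_of_mem_primesOver hp hQ, Ideal.absNorm_apply, Submodule.cardQuot_apply]

/-- If `x ^ n ≡ x` modulo a prime `Q` for all `x` then the residue field has at most `n` elements. -/
theorem card_quotient_le_of_pow_sub_mem {R : Type*} [CommRing R] {Q : Ideal R} [Q.IsPrime]
    {n : ℕ} (hn : 1 < n) (h : ∀ x : R, x ^ n - x ∈ Q) : Nat.card (R ⧸ Q) ≤ n := by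
  classical
  set f : Polynomial (R ⧸ Q) := Polynomial.X ^ n - Polynomial.X with hf
  have hdeg : f.natDegree ≤ n := by
    rw [hf]
    compute_degree
    exact max_le le_rfl hn.le
  have hf0 : f ≠ 0 := by
    intro h0
    have := congrArg (Polynomial.coeff · n) h0
    simp [hf, Polynomial.coeff_X, hn.ne] at this
  have hroot : ∀ x : R ⧸ Q, x ∈ f.roots.toFinset := by
    intro x
    obtain ⟨y, rfl⟩ := Ideal.Quotient.mk_surjective x
    rw [Multiset.mem_toFinset, Polynomial.mem_roots hf0, Polynomial.IsRoot.def]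
    simp only [hf, Polynomial.eval_sub, Polynomial.eval_pow, Polynomial.eval_X, ← map_pow,
      ← map_sub]
    exact Ideal.Quotient.eq_zero_iff_mem.2 (h y)
  have : Fintype (R ⧸ Q) := ⟨_, hroot⟩
  rw [Nat.card_eq_fintype_card, ← Finset.card_univ]
  calc _ ≤ f.roots.toFinset.card := Finset.card_le_card fun x _ => hroot x
    _ ≤ f.roots.card := Multiset.toFinset_card_le _
    _ ≤ n := f.card_roots'.trans hdeg

variable [IsGalois ℚ K]

/-- The `f`-th power of Frobenius acts trivially on the residue field of `p ^ f` elements, so it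
lies in the inertia group, which is trivial when `e = 1`. Conversely, if the `k`-th power is `1`,
then `x ^ (p ^ k) = x` on that field, so `p ^ f ≤ p ^ k`. The second claim is `e f g = |G|`. -/
theorem orderOf_frob {p : ℕ} (hp : p.Prime) (hpr : p ∉ ramifiedPrimes K) :
    orderOf (frob K p) = (Ideal.span {(p : ℤ)}).inertiaDegIn (𝓞 K) ∧
    ((Ideal.span {(p : ℤ)}).primesOver (𝓞 K)).ncard * orderOf (frob K p) =
      Nat.card (K ≃ₐ[ℚ] K) := by
  obtain ⟨Q, hQ, hσ⟩ := exists_isArithFrobAt_frob (K := K) hp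
  have := hQ.1
  have := hQ.2
  have hmax := isMaximal_span_natCast hp
  have he : Q.ramificationIdx ℤ = 1 := by
    by_contra h
    exact hpr ⟨hp, Q, hQ, h⟩
  have heIn : (Ideal.span {(p : ℤ)}).ramificationIdxIn (𝓞 K) = 1 := by
    rw [Ideal.ramificationIdxIn_eq_ramificationIdx _ Q (K ≃ₐ[ℚ] K), he]
  have hfIn : (Ideal.span {(p : ℤ)}).inertiaDegIn (𝓞 K) = Q.inertiaDeg ℤ :=
    Ideal.inertiaDegIn_eq_inertiaDeg _ Q (K ≃ₐ[ℚ] K)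
  have hfpos : 0 < Q.inertiaDeg ℤ := Q.inertiaDeg_pos ℤ
  have hfinQ : Finite (𝓞 K ⧸ Q) :=
    Ring.HasFiniteQuotients.finiteQuotient (ne_bot_of_mem_primesOver hp hQ)
  have hQmax : Q.IsMaximal := hQ.1.isMaximal (ne_bot_of_mem_primesOver hp hQ)
  have hfinp : Finite (ℤ ⧸ Ideal.span {(p : ℤ)}) :=
    Ring.HasFiniteQuotients.finiteQuotient (by simpa using hp.ne_zero)
  have hinertia : Nat.card (Q.inertia (K ≃ₐ[ℚ] K)) = 1 := by
    rw [Ideal.card_inertia_eq_ramificationIdxIn (Ideal.span {(p : ℤ)}) Q, heIn]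
  have horder : orderOf (frob K p) = Q.inertiaDeg ℤ := by
    refine Nat.le_antisymm (orderOf_le_of_pow_eq_one hfpos ?_) ?_
    · have hmem : frob K p ^ Q.inertiaDeg ℤ ∈ Q.inertia (K ≃ₐ[ℚ] K) := by
        intro x
        have h1 := IsArithFrobAt.pow_smul_sub_mem hQ hσ (Q.inertiaDeg ℤ) x
        have h2 : x ^ p ^ Q.inertiaDeg ℤ - x ∈ Q := by
          let := Ideal.Quotient.field Q
          let := Fintype.ofFinite (𝓞 K ⧸ Q)
          rw [← Ideal.Quotient.eq, map_pow, ← card_quotient_of_mem_primesOver hp hQ,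
            Nat.card_eq_fintype_card, FiniteField.pow_card]
        have := Q.add_mem h1 h2
        rwa [sub_add_sub_cancel] at this
      rw [Subgroup.card_eq_one.1 hinertia] at hmem
      exact hmem
    · have hopos := orderOf_pos (frob K p)
      have h1 : ∀ x : 𝓞 K, x ^ p ^ orderOf (frob K p) - x ∈ Q := by
        intro x
        have := IsArithFrobAt.pow_smul_sub_mem hQ hσ (orderOf (frob K p)) x
        rw [pow_orderOf_eq_one, one_smul] at this
        rw [← neg_sub]
        exact Q.neg_mem this
      have h2 := card_quotient_le_of_pow_sub_mem (Nat.one_lt_pow hopos.ne' hp.one_lt) h1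
      rw [card_quotient_of_mem_primesOver hp hQ] at h2
      exact (Nat.pow_le_pow_iff_right hp.one_lt).1 h2
  refine ⟨horder.trans hfIn.symm, ?_⟩
  have := Ideal.ncard_primesOver_mul_ramificationIdxIn_mul_inertiaDegIn (Ideal.span {(p : ℤ)})
    (𝓞 K) (K ≃ₐ[ℚ] K)
  rwa [heIn, one_mul, hfIn, ← horder] at this

theorem prod_primesAbove_eq {p : ℕ} (hp : p.Prime) (s : ℂ) :
    ∏ P ∈ primesAbove K p, (1 - (p : ℂ) ^ (-(P.inertiaDeg ℤ : ℂ) * s)) =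
      (1 - (p : ℂ) ^ (-((Ideal.span {(p : ℤ)}).inertiaDegIn (𝓞 K) : ℂ) * s)) ^
        ((Ideal.span {(p : ℤ)}).primesOver (𝓞 K)).ncard := by
  rw [← card_primesAbove hp]
  refine Finset.prod_eq_pow_card fun P hP => ?_
  rw [mem_primesAbove hp] at hP
  have := hP.1
  have := hP.2
  rw [Ideal.inertiaDegIn_eq_inertiaDeg _ P (K ≃ₐ[ℚ] K)]

end Frobenius

/-! ### The completely multiplicative extension of a character -/

section CharNat

variable {K : Type*} [Field K] [NumberField K] (χ : (K ≃ₐ[ℚ] K) →* ℂˣ)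

theorem charNat_zero : charNat χ 0 = 0 := by simp [charNat]

theorem charNat_one : charNat χ 1 = 1 := by simp [charNat]

theorem charNat_mul (a b : ℕ) : charNat χ (a * b) = charNat χ a * charNat χ b := by
  rcases eq_or_ne a 0 with rfl | ha
  · simp [charNat_zero]
  rcases eq_or_ne b 0 with rfl | hb
  · simp [charNat_zero]
  rw [charNat, charNat, charNat, if_neg (mul_ne_zero ha hb), if_neg ha, if_neg hb,
    Nat.factorization_mul ha hb, Finsupp.prod_add_index' (by simp) fun p => pow_add _]

theorem charNat_prime {p : ℕ} (hp : p.Prime) : charNat χ p = charPrime χ p := by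
  rw [charNat, if_neg hp.ne_zero, hp.factorization, Finsupp.prod_single_index
    (h := fun p k => charPrime χ p ^ k) (pow_zero _), pow_one]

/-- The completely multiplicative function `n ↦ χ(n)`. -/
noncomputable def charNatHom : ℕ →*₀ ℂ where
  toFun := charNat χ
  map_zero' := charNat_zero χ
  map_one' := charNat_one χ
  map_mul' := charNat_mul χ

theorem norm_charPrime_le_one (p : ℕ) : ‖charPrime χ p‖ ≤ 1 := by
  rw [charPrime]
  split_ifs
  · simp
  · refine (Complex.norm_eq_one_of_pow_eq_one (n := Nat.card (K ≃ₐ[ℚ] K)) ?_ Nat.card_pos.ne').le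
    rw [← Units.val_pow_eq_pow_val, ← map_pow, pow_card_eq_one', map_one, Units.val_one]

theorem norm_charNat_le_one (n : ℕ) : ‖charNat χ n‖ ≤ 1 := by
  rw [charNat]
  split_ifs
  · simp
  · rw [Finsupp.prod, norm_prod]
    refine Finset.prod_le_one (fun _ _ => norm_nonneg _) fun p _ => ?_
    rw [norm_pow]
    exact pow_le_one₀ (norm_nonneg _) (norm_charPrime_le_one χ p)

theorem lseriesSummable_charNat {s : ℂ} (hs : 1 < s.re) : LSeriesSummable (charNat χ) s :=
  LSeriesSummable_of_bounded_of_one_lt_re (fun n _ => norm_charNat_le_one χ n) hs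

theorem tendsto_prod_charPrime {s : ℂ} (hs : 1 < s.re) :
    Tendsto (fun N : ℕ => ∏ p ∈ N.primesBelow, (1 - charPrime χ p * (p : ℂ) ^ (-s))⁻¹) atTop
      (𝓝 (LSeries (charNat χ) s)) := by
  have hs0 : s ≠ 0 := by
    rintro rfl
    norm_num at hs
  let f : ℕ →*₀ ℂ := charNatHom χ * riemannZetaSummandHom hs0
  have hf : ∀ n, f n = charNat χ n * (n : ℂ) ^ (-s) := fun _ => rfl
  have hterm : ∀ n, f n = LSeries.term (charNat χ) s n := by
    intro n
    rw [hf, LSeries.term_def]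
    split_ifs with hn
    · rw [hn, charNat_zero, zero_mul]
    · rw [Complex.cpow_neg, div_eq_mul_inv]
  have hsum : Summable fun n => ‖f n‖ :=
    (lseriesSummable_charNat χ hs).norm.congr fun n => by rw [hterm]
  have h := EulerProduct.eulerProduct_completely_multiplicative hsum
  rw [tsum_congr hterm] at h
  refine h.congr fun N => Finset.prod_congr rfl fun p hp => ?_
  rw [hf, charNat_prime χ (Nat.prime_of_mem_primesBelow hp)]

end CharNat

/-! ### Factorisation of the zeta function of an abelian field -/

section Product

variable {K : Type*} [Field K] [NumberField K]

theorem natCast_cpow_norm_lt_one {p : ℕ} (hp : p.Prime) {z : ℂ} (hz : z.re < 0) :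
    ‖(p : ℂ) ^ z‖ < 1 := by
  rw [Complex.norm_natCast_cpow_of_pos hp.pos]
  exact Real.rpow_lt_one_of_one_lt_of_neg (by exact_mod_cast hp.one_lt) hz

theorem one_sub_ne_zero_of_norm_lt_one {z : ℂ} (hz : ‖z‖ < 1) : 1 - z ≠ 0 := by
  intro h
  rw [← sub_eq_zero.1 h] at hz
  simp at hz

theorem finite_characters : Finite ((K ≃ₐ[ℚ] K) →* ℂˣ) := by
  have hc : Finite (K ≃ₐ[ℚ] K) := inferInstance
  have : NeZero (Nat.card (K ≃ₐ[ℚ] K)) := ⟨Nat.card_pos.ne'⟩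
  have hfin : Finite (rootsOfUnity (Nat.card (K ≃ₐ[ℚ] K)) ℂ) := inferInstance
  refine Finite.of_injective (β := (K ≃ₐ[ℚ] K) → rootsOfUnity (Nat.card (K ≃ₐ[ℚ] K)) ℂ)
    (fun χ σ => ⟨χ σ, ?_⟩) fun χ ψ h => ?_
  · rw [mem_rootsOfUnity, ← map_pow, pow_card_eq_one', map_one]
  · exact MonoidHom.ext fun σ => congrArg Subtype.val (congrFun h σ)

variable [IsAbelianGalois ℚ K]

theorem prod_primesAbove_eq_prod_charPrime [Fintype ((K ≃ₐ[ℚ] K) →* ℂˣ)] {p : ℕ} (hp : p.Prime)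
    (hpr : p ∉ ramifiedPrimes K) (s : ℂ) :
    ∏ P ∈ primesAbove K p, (1 - (p : ℂ) ^ (-(P.inertiaDeg ℤ : ℂ) * s)) =
      ∏ χ : (K ≃ₐ[ℚ] K) →* ℂˣ, (1 - charPrime χ p * (p : ℂ) ^ (-s)) := by
  obtain ⟨h1, h2⟩ := orderOf_frob hp hpr
  have h3 : ∏ χ : (K ≃ₐ[ℚ] K) →* ℂˣ, (1 - charPrime χ p * (p : ℂ) ^ (-s)) =
      ∏ χ : (K ≃ₐ[ℚ] K) →* ℂˣ, (1 - (χ (frob K p) : ℂ) * (p : ℂ) ^ (-s)) :=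
    Finset.prod_congr rfl fun χ _ => by rw [charPrime, if_neg hpr]
  rw [prod_primesAbove_eq hp, ← h1, h3]
  let : CommGroup (K ≃ₐ[ℚ] K) := { mul_comm := fun a b => mul_comm' a b }
  rw [prod_one_sub_apply_mul (frob K p) h2, ← Complex.cpow_nat_mul, mul_neg, neg_mul]

theorem dedekindZeta_eq_correctionFactor_mul {s : ℂ} (hs : 1 < s.re) :
    dedekindZeta K s =
      correctionFactor K s * ∏ᶠ χ : (K ≃ₐ[ℚ] K) →* ℂˣ, LSeries (charNat χ) s := by
  classical
  have := finite_characters (K := K)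
  have := Fintype.ofFinite ((K ≃ₐ[ℚ] K) →* ℂˣ)
  have hRfin := finite_ramifiedPrimes (K := K)
  set R : Finset ℕ := hRfin.toFinset with hR
  have hRmem : ∀ p, p ∈ R ↔ p ∈ ramifiedPrimes K := fun p => hRfin.mem_toFinset
  rw [finprod_eq_prod_of_fintype]
  set E : ℕ → ℂ := fun p => ∏ P ∈ primesAbove K p, (1 - (p : ℂ) ^ (-(P.inertiaDeg ℤ : ℂ) * s))
    with hE
  have hF : correctionFactor K s = (∏ p ∈ R, E p)⁻¹ := by
    rw [correctionFactor, finprod_mem_eq_finite_toFinset_prod _ hRfin, ← Finset.prod_inv_distrib]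
    refine Finset.prod_congr rfl fun p hp => ?_
    have hp' : p.Prime := ((hRmem p).1 hp).1
    simp only [hE]
    rw [prod_primesAbove_eq hp', inv_pow]
  have hE0 : ∀ p : ℕ, p.Prime → E p ≠ 0 := by
    intro p hp
    refine Finset.prod_ne_zero_iff.2 fun P hP => one_sub_ne_zero_of_norm_lt_one
      (natCast_cpow_norm_lt_one hp ?_)
    rw [mem_primesAbove hp] at hP
    have := hP.1
    have hf : 0 < (P.inertiaDeg ℤ : ℝ) := by exact_mod_cast P.inertiaDeg_pos ℤ
    simp only [neg_mul, Complex.neg_re, Complex.mul_re, Complex.natCast_re,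
      Complex.natCast_im, zero_mul, sub_zero, Left.neg_neg_iff]
    exact mul_pos hf (by linarith)
  have hC0 : ∀ p : ℕ, p.Prime → ∀ χ : (K ≃ₐ[ℚ] K) →* ℂˣ,
      1 - charPrime χ p * (p : ℂ) ^ (-s) ≠ 0 := by
    intro p hp χ
    refine one_sub_ne_zero_of_norm_lt_one ?_
    rw [norm_mul]
    refine (mul_le_of_le_one_left (norm_nonneg _) (norm_charPrime_le_one χ p)).trans_lt
      (natCast_cpow_norm_lt_one hp ?_)
    rw [Complex.neg_re]
    linarith
  have hlim1 := tendsto_dedekindZeta_mul_prod (K := K) hs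
  have hlim2 := tendsto_finsetProd (Finset.univ : Finset ((K ≃ₐ[ℚ] K) →* ℂˣ))
    fun χ _ => tendsto_prod_charPrime χ hs
  have hlim := hlim1.mul hlim2
  rw [one_mul] at hlim
  -- Once `N` exceeds all ramified primes the truncated product is constant: unramified factors
  -- cancel, and ramified ones leave `E p`. Comparing with its limit gives the identity.
  have hev : ∀ᶠ N : ℕ in atTop, dedekindZeta K s * (∏ p ∈ N.primesBelow, E p) *
      ∏ χ : (K ≃ₐ[ℚ] K) →* ℂˣ, ∏ p ∈ N.primesBelow, (1 - charPrime χ p * (p : ℂ) ^ (-s))⁻¹ =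
      dedekindZeta K s * ∏ p ∈ R, E p := by
    obtain ⟨M, hM⟩ := R.exists_nat_subset_range
    filter_upwards [eventually_ge_atTop M] with N hN
    have hsub : R ⊆ N.primesBelow := fun p hp =>
      Nat.mem_primesBelow.2 ⟨(Finset.mem_range.1 (hM hp)).trans_le hN, ((hRmem p).1 hp).1⟩
    rw [Finset.prod_comm, mul_assoc, ← Finset.prod_mul_distrib, ← Finset.prod_subset hsub]
    · congr 1
      refine Finset.prod_congr rfl fun p hp => ?_
      rw [Finset.prod_eq_one, mul_one]
      intro χ _
      rw [charPrime, if_pos ((hRmem p).1 hp), zero_mul, sub_zero, inv_one]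
    · intro p hp hpR
      have hp' := Nat.prime_of_mem_primesBelow hp
      simp only [hE]
      rw [prod_primesAbove_eq_prod_charPrime hp' (fun h => hpR ((hRmem p).2 h)),
        Finset.prod_inv_distrib, mul_inv_cancel₀]
      exact Finset.prod_ne_zero_iff.2 fun χ _ => hC0 p hp' χ
  have := tendsto_nhds_unique (tendsto_const_nhds.congr' (hev.mono fun N h => h.symm)) hlim
  rw [hF, ← this]
  have hne : ∏ p ∈ R, E p ≠ 0 :=
    Finset.prod_ne_zero_iff.2 fun p hp => hE0 p ((hRmem p).1 hp).1
  field_simp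

end Product

/-! ### Abel summation with bounded partial sums -/

section PartialSums

theorem sum_Icc_one_eq_sum_range (a : ℕ → ℂ) (n : ℕ) :
    ∑ k ∈ Finset.Icc 1 n, a k = ∑ k ∈ Finset.range n, a (k + 1) := by
  induction n with
  | zero => simp
  | succ n ih => rw [Finset.sum_Icc_succ_top (by omega), ih, Finset.sum_range_succ]

theorem sum_Icc_zero_eq_sum_Icc_one {a : ℕ → ℂ} (h : a 0 = 0) (n : ℕ) :
    ∑ k ∈ Finset.Icc 0 n, a k = ∑ k ∈ Finset.Icc 1 n, a k := by
  rw [Finset.Icc_eq_cons_Ioc (Nat.zero_le n), Finset.sum_cons, h, zero_add]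
  rfl

/-- The partial sums of a periodic sequence with vanishing sum over a period are bounded. -/
theorem norm_sum_Icc_le_of_periodic {a : ℕ → ℂ} {m : ℕ} (hper : ∀ n, 0 < n → a (n + m) = a n)
    (hm : 0 < m) (hsum : ∑ k ∈ Finset.Icc 1 m, a k = 0) (n : ℕ) :
    ‖∑ k ∈ Finset.Icc 1 n, a k‖ ≤ ∑ k ∈ Finset.Icc 1 m, ‖a k‖ := by
  induction n using Nat.strong_induction_on with
  | _ n ih =>
    rcases le_or_gt n m with h | h
    · exact (norm_sum_le _ _).trans (Finset.sum_le_sum_of_subset_of_nonneg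
        (Finset.Icc_subset_Icc_right h) fun _ _ _ => norm_nonneg _)
    · obtain ⟨k, rfl⟩ := Nat.exists_eq_add_of_le h.le
      have h1 := ih k (by omega)
      have h2 : ∑ j ∈ Finset.Icc 1 (m + k), a j = ∑ j ∈ Finset.Icc 1 k, a j := by
        rw [sum_Icc_one_eq_sum_range, Finset.sum_range_add, ← sum_Icc_one_eq_sum_range, hsum,
          zero_add, sum_Icc_one_eq_sum_range]
        refine Finset.sum_congr rfl fun j _ => ?_
        rw [← hper (j + 1) (by omega)]
        congr 1
        omega
      rwa [h2]

variable {a : ℕ → ℂ} {C : ℝ} (hC : ∀ n, ‖∑ k ∈ Finset.Icc 1 n, a k‖ ≤ C)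

include hC in
theorem norm_le_of_norm_sum_Icc_le {n : ℕ} (hn : n ≠ 0) : ‖a n‖ ≤ 2 * C := by
  obtain ⟨k, rfl⟩ := Nat.exists_eq_succ_of_ne_zero hn
  have h : a (k + 1) = ∑ j ∈ Finset.Icc 1 (k + 1), a j - ∑ j ∈ Finset.Icc 1 k, a j := by
    rw [Finset.sum_Icc_succ_top (by omega), add_sub_cancel_left]
  rw [Nat.succ_eq_add_one, h]
  exact (norm_sub_le _ _).trans (by linarith [hC (k + 1), hC k])

/-- If the partial sums of `a` are bounded, then the series `∑ a(n) / n` converges. -/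
theorem tendsto_sum_div_of_norm_sum_Icc_le (hC : ∀ n, ‖∑ k ∈ Finset.Icc 1 n, a k‖ ≤ C) :
    Tendsto (fun N : ℕ => ∑ n ∈ Finset.Icc 1 N, a n / n) atTop
      (𝓝 (∫ t in Set.Ioi (1 : ℝ), (∑ k ∈ Finset.Icc 1 ⌊t⌋₊, a k) * (t : ℂ) ^ (-2 : ℂ))) := by
  have hderiv : ∀ t : ℝ, t ≠ 0 →
      HasDerivAt (fun t : ℝ => (t : ℂ)⁻¹) (-((t : ℂ) ^ (-2 : ℂ))) t := by
    intro t ht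
    have h0 : (t : ℂ) ≠ 0 := by exact_mod_cast ht
    have h := (hasDerivAt_inv h0).comp_ofReal
    have h2 : (t : ℂ) ^ (-2 : ℂ) = ((t : ℂ) ^ 2)⁻¹ := by
      rw [Complex.cpow_neg]; norm_cast
    rw [h2]
    exact h
  -- The summation formula starts at index `0`, where the value of `a` is arbitrary.
  set c : ℕ → ℂ := fun n => if n = 0 then 0 else a n with hc
  have hcs : ∀ n, ∑ k ∈ Finset.Icc 0 n, c k = ∑ k ∈ Finset.Icc 1 n, a k := by
    intro n
    rw [sum_Icc_zero_eq_sum_Icc_one (by simp [hc])]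
    refine Finset.sum_congr rfl fun k hk => if_neg ?_
    have := (Finset.mem_Icc.1 hk).1
    omega
  have hcont : ContinuousOn (fun t : ℝ => -((t : ℂ) ^ (-2 : ℂ))) (Set.Ici 1) := by
    refine ContinuousOn.neg ?_
    refine fun t ht => ContinuousAt.continuousWithinAt ?_
    refine ContinuousAt.cpow Complex.continuous_ofReal.continuousAt continuousAt_const (Or.inl ?_)
    rw [Complex.ofReal_re]
    exact lt_of_lt_of_le one_pos ht
  have hd : ∀ t ∈ Set.Ici (1 : ℝ),
      deriv (fun t : ℝ => (t : ℂ)⁻¹) t = -((t : ℂ) ^ (-2 : ℂ)) := fun t ht =>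
    (hderiv t (lt_of_lt_of_le one_pos ht).ne').deriv
  have hnorm : ∀ t ∈ Set.Ici (1 : ℝ), ‖(t : ℂ) ^ (-2 : ℂ)‖ = t ^ (-2 : ℝ) := by
    intro t ht
    rw [Complex.norm_cpow_eq_rpow_re_of_pos (lt_of_lt_of_le one_pos ht)]
    simp
  have key := tendsto_sum_mul_atTop_nhds_one_sub_integral₀ (𝕜 := ℂ) (c := c)
    (f := fun t : ℝ => (t : ℂ)⁻¹) (l := 0) (g := fun t => t ^ (-2 : ℝ)) (by simp [hc])
    (fun t ht => (hderiv t (lt_of_lt_of_le one_pos ht).ne').differentiableAt)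
    ((hcont.congr hd).locallyIntegrableOn measurableSet_Ici) ?_ ?_ ?_
  · rw [zero_sub, ← integral_neg] at key
    have h1 : ∫ t in Set.Ioi (1 : ℝ), -(deriv (fun t : ℝ => (t : ℂ)⁻¹) t *
        ∑ k ∈ Finset.Icc 0 ⌊t⌋₊, c k) =
        ∫ t in Set.Ioi (1 : ℝ), (∑ k ∈ Finset.Icc 1 ⌊t⌋₊, a k) * (t : ℂ) ^ (-2 : ℂ) := by
      refine setIntegral_congr_fun measurableSet_Ioi fun t ht => ?_
      rw [hd t (Set.Ioi_subset_Ici_self ht), hcs]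
      ring
    rw [h1] at key
    refine key.congr fun N => ?_
    rw [sum_Icc_zero_eq_sum_Icc_one (by simp [hc])]
    refine Finset.sum_congr rfl fun k hk => ?_
    have := (Finset.mem_Icc.1 hk).1
    simp only [hc]
    rw [if_neg (by omega), Complex.ofReal_natCast, div_eq_inv_mul]
  -- The boundary term is at most `C / n`.
  · simp only [hcs]
    have h1 : Tendsto (fun n : ℕ => (n : ℝ)⁻¹ * C) atTop (𝓝 0) := by
      simpa using (tendsto_inv_atTop_nhds_zero_nat (𝕜 := ℝ)).mul_const C
    refine squeeze_zero_norm (fun n => ?_) h1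
    rw [norm_mul, norm_inv, Complex.ofReal_natCast, Complex.norm_natCast]
    gcongr
    exact hC n
  · refine Asymptotics.IsBigO.of_bound C ?_
    filter_upwards [eventually_ge_atTop 1] with t ht
    rw [hd t ht, hcs, norm_mul, norm_neg, hnorm t ht, Real.norm_of_nonneg (by positivity), mul_comm]
    gcongr
    exact hC _
  · exact ⟨Set.Ioi 1, Ioi_mem_atTop 1, integrableOn_Ioi_rpow_of_lt (by norm_num) one_pos⟩

/-- If the partial sums of `a` are bounded, then the L-series of `a` is continuous at `1` from the
half-plane of absolute convergence. -/
theorem tendsto_LSeries_of_norm_sum_Icc_le (hC : ∀ n, ‖∑ k ∈ Finset.Icc 1 n, a k‖ ≤ C) :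
    Tendsto (LSeries a) (𝓝[{s : ℂ | 1 < s.re}] 1)
      (𝓝 (∫ t in Set.Ioi (1 : ℝ), (∑ k ∈ Finset.Icc 1 ⌊t⌋₊, a k) * (t : ℂ) ^ (-2 : ℂ))) := by
  have hC0 : 0 ≤ C := (norm_nonneg _).trans (hC 0)
  have hrep : ∀ s ∈ {s : ℂ | 1 < s.re}, s * (∫ t in Set.Ioi (1 : ℝ),
      (∑ k ∈ Finset.Icc 1 ⌊t⌋₊, a k) * (t : ℂ) ^ (-(s + 1))) = LSeries a s := by
    intro s hs
    refine (LSeries_eq_mul_integral a (r := 0) le_rfl (one_pos.trans hs) ?_ ?_).symm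
    · exact LSeriesSummable_of_bounded_of_one_lt_re
        (fun n hn => norm_le_of_norm_sum_Icc_le hC hn) hs
    · refine Asymptotics.IsBigO.of_bound C (Eventually.of_forall fun n => ?_)
      simpa using hC n
  have hmeas : Measurable fun t : ℝ => ∑ k ∈ Finset.Icc 1 ⌊t⌋₊, a k :=
    (measurable_from_nat (f := fun n => ∑ k ∈ Finset.Icc 1 n, a k)).comp Nat.measurable_floor
  have hint : Tendsto (fun s : ℂ => ∫ t in Set.Ioi (1 : ℝ),
      (∑ k ∈ Finset.Icc 1 ⌊t⌋₊, a k) * (t : ℂ) ^ (-(s + 1))) (𝓝[{s : ℂ | 1 < s.re}] 1)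
      (𝓝 (∫ t in Set.Ioi (1 : ℝ), (∑ k ∈ Finset.Icc 1 ⌊t⌋₊, a k) * (t : ℂ) ^ (-2 : ℂ))) := by
    -- For `Re s > 1` and `t > 1` the integrand is bounded by `C * t ^ (-2)`, uniformly in `s`. The
    -- limit is the integral that gives the value of the series at `1`.
    refine tendsto_integral_filter_of_dominated_convergence (fun t => C * t ^ (-2 : ℝ)) ?_ ?_ ?_ ?_
    · refine Eventually.of_forall fun s => (hmeas.mul ?_).aestronglyMeasurable
      exact Complex.measurable_ofReal.pow_const _
    · filter_upwards [self_mem_nhdsWithin] with s hs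
      filter_upwards [ae_restrict_mem measurableSet_Ioi] with t ht
      have ht0 : (0 : ℝ) < t := one_pos.trans ht
      rw [norm_mul, Complex.norm_cpow_eq_rpow_re_of_pos ht0]
      refine mul_le_mul (hC _) (Real.rpow_le_rpow_of_exponent_le (le_of_lt ht) ?_)
        (by positivity) hC0
      simp only [Complex.neg_re, Complex.add_re, Complex.one_re]
      have : 1 < s.re := hs
      linarith
    · exact (integrableOn_Ioi_rpow_of_lt (by norm_num) one_pos).const_mul C
    · filter_upwards [ae_restrict_mem measurableSet_Ioi] with t ht
      have ht0 : (t : ℂ) ≠ 0 := by exact_mod_cast (one_pos.trans ht).ne'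
      refine Tendsto.mono_left ?_ nhdsWithin_le_nhds
      have hcont : Continuous fun s : ℂ => (∑ k ∈ Finset.Icc 1 ⌊t⌋₊, a k) * (t : ℂ) ^ (-(s + 1)) :=
        continuous_const.mul (Continuous.const_cpow (by fun_prop) (Or.inl ht0))
      have h2 : (-2 : ℂ) = -(1 + 1) := by norm_num
      rw [h2]
      exact hcont.tendsto 1
  have h1 : Tendsto (fun s : ℂ => s) (𝓝[{s : ℂ | 1 < s.re}] 1) (𝓝 1) :=
    tendsto_id.mono_left nhdsWithin_le_nhds
  have h2 := h1.mul hint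
  rw [one_mul] at h2
  refine h2.congr' ?_
  filter_upwards [self_mem_nhdsWithin] with s hs using hrep s hs

end PartialSums

/-! ### Gauss sums and logarithms at roots of unity -/

section RootsOfUnity

/-- The Taylor series of the logarithm at nontrivial roots of unity. -/
theorem tendsto_sum_pow_div_of_pow_eq_one {z : ℂ} {m : ℕ} (hm : 0 < m) (hz : z ^ m = 1)
    (hz1 : z ≠ 1) :
    Tendsto (fun N : ℕ => ∑ n ∈ Finset.Icc 1 N, z ^ n / n) atTop (𝓝 (-Complex.log (1 - z))) := by
  have hsum : ∑ k ∈ Finset.Icc 1 m, z ^ k = 0 := by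
    rw [sum_Icc_one_eq_sum_range]
    simp_rw [pow_succ']
    rw [← Finset.mul_sum, geom_sum_eq hz1, hz, sub_self, zero_div, mul_zero]
  have hlim := tendsto_sum_div_of_norm_sum_Icc_le (norm_sum_Icc_le_of_periodic
    (a := fun n => z ^ n) (m := m) (fun n _ => by rw [pow_add, hz, mul_one]) hm hsum)
  set ℓ := ∫ t in Set.Ioi (1 : ℝ), (∑ k ∈ Finset.Icc 1 ⌊t⌋₊, z ^ k) * (t : ℂ) ^ (-2 : ℂ) with hℓ
  suffices ℓ = -Complex.log (1 - z) by rwa [← this]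
  have hrange : Tendsto (fun N => ∑ n ∈ Finset.range N, z ^ n / (n : ℂ)) atTop (𝓝 ℓ) := by
    rw [← tendsto_add_atTop_iff_nat 1]
    refine hlim.congr fun N => ?_
    rw [sum_Icc_one_eq_sum_range (fun n => z ^ n / n), Finset.sum_range_succ']
    simp
  -- Abel's limit theorem carries the logarithm series from inside the disc to the boundary. The
  -- principal logarithm is continuous there because `Re (1 - z) > 0`.
  have habel := Complex.tendsto_tsum_powerSeries_nhdsWithin_lt hrange
  rw [tendsto_map'_iff] at habel
  have hnz : ‖z‖ = 1 := Complex.norm_eq_one_of_pow_eq_one hz hm.ne'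
  have hre : z.re < 1 := by
    refine lt_of_le_of_ne ((Complex.re_le_norm z).trans hnz.le) fun h => hz1 ?_
    have h2 : z.re ^ 2 + z.im ^ 2 = 1 := by
      have := Complex.sq_norm z
      rw [hnz, Complex.normSq_apply] at this
      linarith
    refine Complex.ext h ?_
    rw [h] at h2
    have : z.im ^ 2 = 0 := by linarith
    simpa using this
  have hlog : Tendsto (fun r : ℝ => -Complex.log (1 - r * z)) (𝓝[<] 1)
      (𝓝 (-Complex.log (1 - z))) := by
    refine Tendsto.mono_left ?_ nhdsWithin_le_nhds
    have hc : ContinuousAt (fun r : ℝ => -Complex.log (1 - r * z)) 1 := by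
      refine ContinuousAt.neg (ContinuousAt.clog (by fun_prop) (Or.inl ?_))
      simp only [Complex.ofReal_one, one_mul, Complex.sub_re, Complex.one_re]
      linarith
    have := hc.tendsto
    simpa using this
  refine tendsto_nhds_unique (habel.congr' ?_) hlog
  filter_upwards [Ioo_mem_nhdsLT (show (0 : ℝ) < 1 from one_pos)] with r hr
  have hlt : ‖(r : ℂ) * z‖ < 1 := by
    rw [norm_mul, hnz, mul_one, Complex.norm_real, Real.norm_of_nonneg hr.1.le]
    exact hr.2
  rw [← (Complex.hasSum_taylorSeries_neg_log hlt).tsum_eq]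
  refine tsum_congr fun n => ?_
  rw [mul_pow]
  ring

variable {m : ℕ} {ω : ℂ}

/-- Orthogonality of the powers of a primitive root of unity. -/
theorem sum_pow_mul_inv_pow (hω : IsPrimitiveRoot ω m) (hm : 0 < m) {x n : ℕ} :
    ∑ i ∈ Finset.range m, ω ^ (i * x) * ((ω ^ i)⁻¹) ^ n = if x ≡ n [MOD m] then (m : ℂ) else 0 := by
  have h0 : ω ≠ 0 := hω.ne_zero hm.ne'
  have h1 : ∀ i, ω ^ (i * x) * ((ω ^ i)⁻¹) ^ n = (ω ^ x * (ω ^ n)⁻¹) ^ i := by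
    intro i
    rw [mul_pow, inv_pow, inv_pow, ← pow_mul, ← pow_mul, ← pow_mul, mul_comm x i, mul_comm n i]
  simp_rw [h1]
  have h2 : ω ^ x * (ω ^ n)⁻¹ = 1 ↔ x ≡ n [MOD m] := by
    rw [mul_inv_eq_one₀ (pow_ne_zero _ h0), hω.eq_orderOf]
    exact (hω.isOfFinOrder hm.ne').pow_eq_pow_iff_modEq
  split_ifs with h
  · rw [h2.2 h]
    simp
  · rw [geom_sum_eq (mt h2.1 h), mul_pow, inv_pow, ← pow_mul, ← pow_mul, mul_comm x, mul_comm n,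
      pow_mul, pow_mul, hω.pow_eq_one]
    simp

variable {a : ℕ → ℂ}

theorem gaussianSum_eq_sum (h0 : ∀ x, 0 < x → ¬ x.Coprime m → a x = 0) (i : ℕ) :
    gaussianSum m a ω i = ∑ x ∈ Finset.Icc 1 m, a x * ω ^ (i * x) := by
  refine Finset.sum_filter_of_ne fun x hx h => ?_
  by_contra hx'
  rw [h0 x (Finset.mem_Icc.1 hx).1 hx', zero_mul] at h
  exact h rfl

/-- Fourier inversion for functions periodic modulo `m`. -/
theorem sum_gaussianSum_mul_inv_pow (hm : 0 < m)
    (hper : ∀ x y, 0 < x → 0 < y → x ≡ y [MOD m] → a x = a y)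
    (h0 : ∀ x, 0 < x → ¬ x.Coprime m → a x = 0) (hω : IsPrimitiveRoot ω m) {n : ℕ} (hn : 0 < n) :
    ∑ i ∈ Finset.range m, gaussianSum m a ω i * ((ω ^ i)⁻¹) ^ n = m * a n := by
  -- Representatives are taken in `1..m` because periodicity is assumed only at positive integers.
  obtain ⟨y, hy, hyn⟩ : ∃ y ∈ Finset.Icc 1 m, y ≡ n [MOD m] := by
    rcases Nat.eq_zero_or_pos (n % m) with h | h
    · exact ⟨m, Finset.mem_Icc.2 ⟨hm, le_rfl⟩, by rw [Nat.ModEq, h, Nat.mod_self]⟩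
    · exact ⟨n % m, Finset.mem_Icc.2 ⟨h, (Nat.mod_lt _ hm).le⟩, Nat.mod_modEq _ _⟩
  have hy1 := Finset.mem_Icc.1 hy
  simp_rw [gaussianSum_eq_sum h0, Finset.sum_mul]
  rw [Finset.sum_comm]
  simp_rw [mul_assoc, ← Finset.mul_sum, sum_pow_mul_inv_pow hω hm]
  rw [Finset.sum_eq_single_of_mem y hy, if_pos hyn, hper y n hy1.1 hn hyn, mul_comm]
  intro x hx hxy
  rw [if_neg, mul_zero]
  intro h
  have hx1 := Finset.mem_Icc.1 hx
  have hxy' : x ≡ y [MOD m] := h.trans hyn.symm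
  refine hxy ?_
  have h3 : x - 1 ≡ y - 1 [MOD m] := by
    refine Nat.ModEq.add_right_cancel' 1 ?_
    rwa [Nat.sub_add_cancel hx1.1, Nat.sub_add_cancel hy1.1]
  have := h3.eq_of_lt_of_lt (by omega) (by omega)
  omega

/-- The value at `1` of the L-series of a function that is periodic modulo `m`, supported on the
integers prime to `m`, and of mean value zero. -/
theorem isLValueAtOne_of_periodic (hm : 0 < m)
    (hper : ∀ x y, 0 < x → 0 < y → x ≡ y [MOD m] → a x = a y)
    (h0 : ∀ x, 0 < x → ¬ x.Coprime m → a x = 0) (hsum : ∑ x ∈ Finset.Icc 1 m, a x = 0)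
    (hω : IsPrimitiveRoot ω m) :
    IsLValueAtOne a (-(1 / m) * ∑ i ∈ Finset.Icc 1 (m - 1),
      gaussianSum m a ω i * Complex.log (1 - (ω ^ i)⁻¹)) := by
  have hb := norm_sum_Icc_le_of_periodic (a := a) (m := m)
    (fun n hn => hper _ _ (by omega) hn (by simp [Nat.ModEq])) hm hsum
  have h1 := tendsto_sum_div_of_norm_sum_Icc_le hb
  have h2 := tendsto_LSeries_of_norm_sum_Icc_le hb
  have hm0 : (m : ℂ) ≠ 0 := by exact_mod_cast hm.ne'
  have hlast : Tendsto (fun N : ℕ => ∑ n ∈ Finset.Icc 1 N, a n / n) atTop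
      (𝓝 (-(1 / m) * ∑ i ∈ Finset.Icc 1 (m - 1),
        gaussianSum m a ω i * Complex.log (1 - (ω ^ i)⁻¹))) := by
    have hN : ∀ N : ℕ, ∑ n ∈ Finset.Icc 1 N, a n / n = (1 / m : ℂ) * ∑ i ∈ Finset.Icc 1 (m - 1),
        gaussianSum m a ω i * ∑ n ∈ Finset.Icc 1 N, ((ω ^ i)⁻¹) ^ n / n := by
      intro N
      have hi : ∀ n ∈ Finset.Icc 1 N, a n / n = (1 / m : ℂ) * ∑ i ∈ Finset.Icc 1 (m - 1),
          gaussianSum m a ω i * (((ω ^ i)⁻¹) ^ n / n) := by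
        intro n hn
        -- Mean zero removes the index `i = 0`, whose series would be the divergent harmonic series.
        have hz : gaussianSum m a ω 0 = 0 := by
          rw [gaussianSum_eq_sum h0]
          simpa using hsum
        have h3 := sum_gaussianSum_mul_inv_pow hm hper h0 hω (Finset.mem_Icc.1 hn).1
        obtain ⟨k, rfl⟩ := Nat.exists_eq_succ_of_ne_zero hm.ne'
        rw [Finset.sum_range_succ', hz, zero_mul, add_zero, ← sum_Icc_one_eq_sum_range
          (fun i => gaussianSum (k + 1) a ω i * ((ω ^ i)⁻¹) ^ n)] at h3
        simp_rw [mul_div_assoc', ← Finset.sum_div]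
        rw [Nat.succ_eq_add_one, Nat.add_sub_cancel, h3]
        field_simp
      rw [Finset.sum_congr rfl hi, ← Finset.mul_sum, Finset.sum_comm]
      simp_rw [← Finset.mul_sum]
    simp_rw [hN]
    have h4 : Tendsto (fun N : ℕ => (1 / m : ℂ) * ∑ i ∈ Finset.Icc 1 (m - 1),
        gaussianSum m a ω i * ∑ n ∈ Finset.Icc 1 N, ((ω ^ i)⁻¹) ^ n / n) atTop
        (𝓝 ((1 / m : ℂ) * ∑ i ∈ Finset.Icc 1 (m - 1),
          gaussianSum m a ω i * -Complex.log (1 - (ω ^ i)⁻¹))) := by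
      refine Tendsto.const_mul _ (tendsto_finsetSum _ fun i hi => Tendsto.const_mul _ ?_)
      have hi' := Finset.mem_Icc.1 hi
      refine tendsto_sum_pow_div_of_pow_eq_one hm ?_ ?_
      · rw [inv_pow, ← pow_mul, mul_comm, pow_mul, hω.pow_eq_one, one_pow, inv_one]
      · rw [Ne, inv_eq_one]
        exact hω.pow_ne_one_of_pos_of_lt (by omega) (by omega)
    convert h4 using 2
    simp only [mul_neg, Finset.sum_neg_distrib, neg_mul]
  refine ⟨hlast, ?_⟩
  rwa [tendsto_nhds_unique hlast h1]

end RootsOfUnity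

/-! ### Almost all primes splitting completely forces degree one -/

section SplitPrimes

variable {L : Type*} [Field L] [NumberField L]

/-- If the residue field at a prime of `L` above `p` unramified in the Galois extension `L` of `ℚ`
is the prime field, then the Euler factor of `L` at `p` is a power of the one of `ℚ`. -/
theorem prod_primesAbove_eq_of_pow_sub_mem [IsGalois ℚ L] {p : ℕ} (hp : p.Prime)
    (hpr : p ∉ ramifiedPrimes L) {P : Ideal (𝓞 L)}
    (hP : P ∈ (Ideal.span {(p : ℤ)}).primesOver (𝓞 L)) (h : ∀ x : 𝓞 L, x ^ p - x ∈ P) (s : ℂ) :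
    ∏ P ∈ primesAbove L p, (1 - (p : ℂ) ^ (-(P.inertiaDeg ℤ : ℂ) * s)) =
      (1 - (p : ℂ) ^ (-s)) ^ Module.finrank ℚ L := by
  have := hP.1
  have := hP.2
  have hcard := card_quotient_le_of_pow_sub_mem hp.one_lt h
  rw [card_quotient_of_mem_primesOver hp hP] at hcard
  have hf1 : P.inertiaDeg ℤ ≤ 1 := by
    rw [← Nat.pow_le_pow_iff_right hp.one_lt, pow_one]
    exact hcard
  have hfpos : 0 < P.inertiaDeg ℤ := P.inertiaDeg_pos ℤ
  have hf : P.inertiaDeg ℤ = 1 := by omega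
  obtain ⟨h1, h2⟩ := orderOf_frob hp hpr
  rw [h1, Ideal.inertiaDegIn_eq_inertiaDeg _ P (L ≃ₐ[ℚ] L), hf, mul_one,
    IsGalois.card_aut_eq_finrank] at h2
  rw [prod_primesAbove_eq hp, Ideal.inertiaDegIn_eq_inertiaDeg _ P (L ≃ₐ[ℚ] L), hf, h2,
    Nat.cast_one, neg_one_mul]

/-- If the Euler factors of the Dedekind zeta function of `L` agree with those of a power of the
Riemann zeta function up to finitely many exceptions, then the zeta functions agree up to the
exceptional Euler factors. -/
theorem dedekindZeta_mul_prod_eq_riemannZeta_pow {B : Finset ℕ} {n : ℕ} {s : ℂ} (hs : 1 < s.re)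
    (h : ∀ p, p.Prime → p ∉ B →
      ∏ P ∈ primesAbove L p, (1 - (p : ℂ) ^ (-(P.inertiaDeg ℤ : ℂ) * s)) =
        (1 - (p : ℂ) ^ (-s)) ^ n) :
    dedekindZeta L s * ∏ p ∈ B with p.Prime,
        (∏ P ∈ primesAbove L p, (1 - (p : ℂ) ^ (-(P.inertiaDeg ℤ : ℂ) * s))) *
          (1 - (p : ℂ) ^ (-s))⁻¹ ^ n = riemannZeta s ^ n := by
  have h1 := (tendsto_dedekindZeta_mul_prod (K := L) hs).mul
    ((riemannZeta_eulerProduct hs).pow n)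
  rw [one_mul] at h1
  refine tendsto_nhds_unique (tendsto_const_nhds.congr' ?_) h1
  filter_upwards [eventually_gt_atTop (B.sup id)] with N hN
  rw [mul_assoc, ← Finset.prod_pow, ← Finset.prod_mul_distrib]
  congr 1
  refine Finset.prod_subset (fun p hp => ?_) fun p hp hpB => ?_
  · rw [Finset.mem_filter] at hp
    exact Nat.mem_primesBelow.2 ⟨(Finset.le_sup (f := id) hp.1).trans_lt hN, hp.2⟩
  · have hpp := Nat.prime_of_mem_primesBelow hp
    rw [h p hpp fun hB => hpB (Finset.mem_filter.2 ⟨hB, hpp⟩), ← mul_pow, mul_inv_cancel₀, one_pow]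
    refine one_sub_ne_zero_of_norm_lt_one (natCast_cpow_norm_lt_one hpp ?_)
    rw [Complex.neg_re]
    linarith

/-- A number field whose Euler factors are almost all `n`-th powers of those of `ℚ` has `n ≤ 1`. -/
theorem le_one_of_prod_primesAbove_eq {B : Finset ℕ} {n : ℕ}
    (h : ∀ p, p.Prime → p ∉ B → ∀ s : ℂ,
      ∏ P ∈ primesAbove L p, (1 - (p : ℂ) ^ (-(P.inertiaDeg ℤ : ℂ) * s)) =
        (1 - (p : ℂ) ^ (-s)) ^ n) : n ≤ 1 := by
  by_contra! hn
  obtain ⟨k, rfl⟩ := Nat.exists_eq_add_of_lt hn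
  set G : ℂ → ℂ := fun s => ∏ p ∈ B with p.Prime,
    (∏ P ∈ primesAbove L p, (1 - (p : ℂ) ^ (-(P.inertiaDeg ℤ : ℂ) * s))) *
      (1 - (p : ℂ) ^ (-s))⁻¹ ^ (1 + k + 1) with hG
  have hof : Tendsto (fun s : ℝ => (s : ℂ)) (𝓝[>] 1) (𝓝 1) :=
    (Complex.continuous_ofReal.tendsto' 1 1 Complex.ofReal_one).mono_left nhdsWithin_le_nhds
  have hGc : ContinuousAt G 1 := by
    refine tendsto_finsetProd _ fun p hp => ?_
    have hpp : p.Prime := (Finset.mem_filter.1 hp).2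
    have hp0 : (p : ℂ) ≠ 0 := by exact_mod_cast hpp.ne_zero
    refine Tendsto.mul (Continuous.tendsto (continuous_finsetProd _ fun P _ =>
      continuous_const.sub (Continuous.const_cpow (by fun_prop) (Or.inl hp0))) 1)
      (Tendsto.pow (Tendsto.inv₀ (Continuous.tendsto
        (continuous_const.sub (Continuous.const_cpow (by fun_prop) (Or.inl hp0))) 1) ?_) _)
    exact one_sub_ne_zero_of_norm_lt_one (natCast_cpow_norm_lt_one hpp (by simp))
  -- With `n = k + 2`, one factor `s - 1` cancels the pole of `ζ_L` and the other `k + 1` send the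
  -- expression to `0`. Up to the finite correction `G` it equals `((s - 1) ζ(s)) ^ n`, which tends
  -- to `1`.
  have h1 : Tendsto (fun s : ℝ => ((s : ℂ) - 1) ^ (k + 1) * (((s : ℂ) - 1) * dedekindZeta L s) *
      G s) (𝓝[>] 1) (𝓝 0) := by
    have h2 : Tendsto (fun s : ℝ => ((s : ℂ) - 1) ^ (k + 1)) (𝓝[>] 1) (𝓝 0) := by
      simpa using (hof.sub_const 1).pow (k + 1)
    simpa using (h2.mul (classNumberFormula L)).mul (hGc.tendsto.comp hof)
  have h3 : Tendsto (fun s : ℝ => (((s : ℂ) - 1) * riemannZeta s) ^ (1 + k + 1)) (𝓝[>] 1)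
      (𝓝 1) := by
    have h4 : Tendsto (fun s : ℝ => (s : ℂ)) (𝓝[>] 1) (𝓝[≠] 1) := by
      refine tendsto_nhdsWithin_iff.2 ⟨hof, ?_⟩
      filter_upwards [self_mem_nhdsWithin] with s hs
      have : (1 : ℝ) < s := hs
      rw [Set.mem_compl_singleton_iff]
      exact_mod_cast this.ne'
    simpa using (riemannZeta_residue_one.comp h4).pow (1 + k + 1)
  refine zero_ne_one (tendsto_nhds_unique (h1.congr' ?_) h3)
  filter_upwards [self_mem_nhdsWithin] with s hs
  have hs' : (1 : ℝ) < (s : ℂ).re := hs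
  rw [mul_pow, ← dedekindZeta_mul_prod_eq_riemannZeta_pow (L := L) hs' fun p hp hpB => h p hp hpB s]
  simp only [hG]
  ring

end SplitPrimes

/-! ### Nontrivial characters are nontrivial on Frobenius elements -/

section Nontrivial

variable {K : Type*} [Field K] [NumberField K] [IsAbelianGalois ℚ K]

/-- A nontrivial character of the Galois group is nontrivial on the Frobenius automorphisms outside
any finite set of primes. -/
theorem exists_prime_apply_frob_ne_one {χ : (K ≃ₐ[ℚ] K) →* ℂˣ} (hχ : χ ≠ 1) {B : Set ℕ}
    (hB : B.Finite) : ∃ p, p.Prime ∧ p ∉ B ∧ χ (frob K p) ≠ 1 := by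
  by_contra! h
  let L := IntermediateField.fixedField χ.ker
  have : IsAbelianGalois ℚ L := .tower_bot ℚ L K
  have hfin := hB.union (finite_ramifiedPrimes (K := L))
  have hle : Module.finrank ℚ L ≤ 1 := by
    refine le_one_of_prod_primesAbove_eq (L := L) (B := hfin.toFinset) fun p hp hpB s => ?_
    rw [Set.Finite.mem_toFinset, Set.mem_union, not_or] at hpB
    obtain ⟨Q, hQ, hσ⟩ := exists_isArithFrobAt_frob (K := K) hp
    have := hQ.1
    have := hQ.2
    refine prod_primesAbove_eq_of_pow_sub_mem hp hpB.2 (P := Q.under (𝓞 L))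
      ⟨inferInstance, ⟨?_⟩⟩ (fun x => ?_) s
    · rw [Ideal.under_under]
      exact hQ.2.over
    · have h1 := IsArithFrobAt.pow_smul_sub_mem hQ hσ 1 (algebraMap (𝓞 L) (𝓞 K) x)
      -- Frobenius lies in `ker χ`, so it fixes `L`, and its congruence becomes `x ^ p ≡ x` modulo
      -- the prime below `Q`.
      have h2 : frob K p • algebraMap (𝓞 L) (𝓞 K) x = algebraMap (𝓞 L) (𝓞 K) x := by
        refine RingOfIntegers.ext ?_
        exact (x : L).2 ⟨frob K p, h p hp hpB.1⟩
      rw [pow_one, pow_one, h2] at h1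
      rw [Ideal.under_def, Ideal.mem_comap, map_sub, map_pow, ← neg_sub]
      exact Q.neg_mem h1
  have hone : Module.finrank ℚ L = 1 := le_antisymm hle Module.finrank_pos
  rw [IntermediateField.finrank_eq_one_iff] at hone
  have hker := IntermediateField.fixingSubgroup_fixedField χ.ker
  rw [show IntermediateField.fixedField χ.ker = ⊥ from hone,
    IntermediateField.fixingSubgroup_bot] at hker
  exact hχ (MonoidHom.ker_eq_top_iff.1 hker.symm)

end Nontrivial

/-! ### Mean value zero and the values at 1 -/

section Values

/-- A completely multiplicative function that is periodic modulo `m` and takes a value other than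
`1` at some integer prime to `m` has mean value zero. -/
theorem sum_Icc_eq_zero_of_mul {a : ℕ → ℂ} {m b : ℕ} (hm : 0 < m)
    (hmul : ∀ x y, a (x * y) = a x * a y)
    (hper : ∀ x y, 0 < x → 0 < y → x ≡ y [MOD m] → a x = a y) (hb0 : 0 < b) (hb : b.Coprime m)
    (hab : a b ≠ 1) : ∑ x ∈ Finset.Icc 1 m, a x = 0 := by
  have hr : ∀ n, 0 < n → (n - 1) % m + 1 ≡ n [MOD m] := by
    intro n hn
    have := (Nat.mod_modEq (n - 1) m).add_right 1
    rwa [Nat.sub_add_cancel hn] at this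
  have hmaps : Set.MapsTo (fun x => (b * x - 1) % m + 1) (Finset.Icc 1 m : Finset ℕ)
      (Finset.Icc 1 m : Finset ℕ) := by
    intro x _
    have := Nat.mod_lt (b * x - 1) hm
    simp only [Finset.coe_Icc, Set.mem_Icc]
    omega
  have hinj : Set.InjOn (fun x => (b * x - 1) % m + 1) (Finset.Icc 1 m : Finset ℕ) := by
    intro x hx y hy hxy
    have hx1 := Finset.mem_Icc.1 hx
    have hy1 := Finset.mem_Icc.1 hy
    have h1 : b * x ≡ b * y [MOD m] := by
      have h2 := hr (b * x) (Nat.mul_pos hb0 hx1.1)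
      rw [show (b * x - 1) % m + 1 = (b * y - 1) % m + 1 from hxy] at h2
      exact h2.symm.trans (hr (b * y) (Nat.mul_pos hb0 hy1.1))
    have h3 : x ≡ y [MOD m] := Nat.ModEq.cancel_left_of_coprime (Nat.coprime_comm.1 hb) h1
    have h4 : x - 1 ≡ y - 1 [MOD m] := by
      refine Nat.ModEq.add_right_cancel' 1 ?_
      rwa [Nat.sub_add_cancel hx1.1, Nat.sub_add_cancel hy1.1]
    have := h4.eq_of_lt_of_lt (by omega) (by omega)
    omega
  -- Multiplication by `b` permutes the residues, so the sum equals `a b` times itself.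
  refine eq_zero_of_mul_eq_self_left hab ?_
  rw [Finset.mul_sum]
  refine Finset.sum_nbij _ hmaps hinj
    (Finset.surjOn_of_injOn_of_card_le _ hmaps hinj le_rfl) fun x hx => ?_
  have hx0 : 0 < b * x := Nat.mul_pos hb0 (Finset.mem_Icc.1 hx).1
  rw [← hmul]
  exact hper _ _ hx0 (Nat.succ_pos _) (hr _ hx0).symm

theorem isLValueAtOne_dirichletCharacter {m : ℕ} [NeZero m] {ψ : DirichletCharacter ℂ m}
    (hψ : ψ ≠ 1) {ω : ℂ} (hω : IsPrimitiveRoot ω m) :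
    IsLValueAtOne (fun n => ψ n) (-(1 / m) * ∑ i ∈ Finset.Icc 1 (m - 1),
      gaussianSum m (fun n => ψ n) ω i * Complex.log (1 - (ω ^ i)⁻¹)) := by
  have hm : 0 < m := NeZero.pos m
  have hper : ∀ x y : ℕ, 0 < x → 0 < y → x ≡ y [MOD m] → ψ x = ψ y := fun x y _ _ h => by
    rw [(ZMod.natCast_eq_natCast_iff x y m).2 h]
  refine isLValueAtOne_of_periodic hm hper (fun x _ hx => ?_) ?_ hω
  · exact ψ.map_nonunit fun h => hx ((ZMod.isUnit_iff_coprime x m).1 h)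
  · obtain ⟨u, hu⟩ := MulChar.ne_one_iff.1 hψ
    -- Adding `m` makes the representative positive without changing its class.
    have hcast : (((u : ZMod m).val + m : ℕ) : ZMod m) = u := by simp
    refine sum_Icc_eq_zero_of_mul (b := (u : ZMod m).val + m) hm
      (fun x y => by rw [Nat.cast_mul, map_mul]) hper (by omega) ?_ ?_
    · rw [← ZMod.isUnit_iff_coprime, hcast]
      exact u.isUnit
    · rwa [hcast]

theorem isLValueAtOne_charNat {K : Type*} [Field K] [NumberField K] [IsAbelianGalois ℚ K]
    {χ : (K ≃ₐ[ℚ] K) →* ℂˣ} (hχ : χ ≠ 1) {m : ℕ} (hm : IsConductor χ m) {ω : ℂ}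
    (hω : IsPrimitiveRoot ω m) :
    IsLValueAtOne (charNat χ) (-(1 / m) * ∑ i ∈ Finset.Icc 1 (m - 1),
      gaussianSum m (charNat χ) ω i * Complex.log (1 - (ω ^ i)⁻¹)) := by
  obtain ⟨hm0, hper, hzero⟩ := hm
  refine isLValueAtOne_of_periodic hm0 hper (fun x _ hx => ?_) ?_ hω
  · obtain ⟨p, hp, ⟨y, rfl⟩, hpm⟩ := Nat.Prime.not_coprime_iff_dvd.1 hx
    rw [charNat_mul, hzero p hp hpm, zero_mul]
  -- The prime must avoid both the ramified primes, where `charPrime` is `0`, and the divisors of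
  -- `m`.
  · obtain ⟨p, hp, hpB, hne⟩ := exists_prime_apply_frob_ne_one hχ
      ((finite_ramifiedPrimes (K := K)).union m.primeFactors.finite_toSet)
    rw [Set.mem_union, not_or] at hpB
    refine sum_Icc_eq_zero_of_mul hm0 (charNat_mul χ) hper hp.pos ?_ ?_ (b := p)
    · rw [hp.coprime_iff_not_dvd]
      exact fun h => hpB.2 (Nat.mem_primeFactors.2 ⟨hp, h, hm0.ne'⟩)
    · rw [charNat_prime χ hp, charPrime, if_neg hpB.1]
      simpa using hne

end Values

end ClassNumberFormula

open ClassNumberFormula in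
theorem mainTheorem2 (K : Type*) [Field K] [NumberField K] :
    -- the Dedekind zeta function is the sum over the nonzero integral ideals
    (∀ s : ℂ, 1 < s.re →
      HasSum (fun I : {I : Ideal (𝓞 K) // I ≠ ⊥} => (Ideal.absNorm I.1 : ℂ) ^ (-s))
        (dedekindZeta K s)) ∧
    -- the measure `ν`, the volume of `(K ⊗ ℝ)ˣ₁ / U` and the class number formula
    (normOneMeasure K).IsHaarMeasure ∧
    HasFundamentalDomain (unitsImageOne K) (normOneGroup K) (normOneMeasure K) ∧
    covolume (unitsImageOne K) (normOneGroup K) (normOneMeasure K) ≠ ⊤ ∧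
    HasFundamentalDomain (unitsImage K) (mixedSpace K)ˣ
      ((unitsMeasure K).restrict (normLeOneUnits K)) ∧
    covolume (unitsImage K) (mixedSpace K)ˣ ((unitsMeasure K).restrict (normLeOneUnits K)) =
      covolume (unitsImageOne K) (normOneGroup K) (normOneMeasure K) ∧
    Tendsto (fun s : ℝ => ((s : ℂ) - 1) * dedekindZeta K s) (𝓝[>] 1)
      (𝓝 (((classNumber K : ℝ) *
        (covolume (unitsImageOne K) (normOneGroup K) (normOneMeasure K)).toReal /
        integersCovolume K : ℝ) : ℂ)) ∧
    integersCovolume K =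
      1 / 2 ^ nrComplexPlaces K * √|(discr K : ℝ)| ∧
    -- abelian fields
    (IsAbelianGalois ℚ K →
      (ramifiedPrimes K).Finite ∧ Finite ((K ≃ₐ[ℚ] K) →* ℂˣ) ∧
      (∀ s : ℂ, 1 < s.re →
        (∀ χ : (K ≃ₐ[ℚ] K) →* ℂˣ, LSeriesSummable (charNat χ) s) ∧
        dedekindZeta K s =
          correctionFactor K s * ∏ᶠ χ : (K ≃ₐ[ℚ] K) →* ℂˣ, LSeries (charNat χ) s) ∧
      ∀ χ : (K ≃ₐ[ℚ] K) →* ℂˣ, χ ≠ 1 → ∀ m : ℕ, IsConductor χ m →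
        ∀ ω : ℂ, IsPrimitiveRoot ω m →
          IsLValueAtOne (charNat χ)
            (-(1 / m) * ∑ i ∈ Finset.Icc 1 (m - 1),
              gaussianSum m (charNat χ) ω i * Complex.log (1 - (ω ^ i)⁻¹))) ∧
    -- nontrivial Dirichlet characters
    (∀ (m : ℕ) [NeZero m] (ψ : DirichletCharacter ℂ m), ψ ≠ 1 →
      ∀ ω : ℂ, IsPrimitiveRoot ω m →
        IsLValueAtOne (fun n => ψ n)
          (-(1 / m) * ∑ i ∈ Finset.Icc 1 (m - 1),
            gaussianSum m (fun n => ψ n) ω i * Complex.log (1 - (ω ^ i)⁻¹))) := by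
  refine ⟨fun s hs => hasSum_dedekindZeta_ne_bot K hs, isHaarMeasure_normOneMeasure K,
    (isFundamentalDomain_unitsDomain_one K _).hasFundamentalDomain _, ?_,
    (isFundamentalDomain_unitsDomain K _).hasFundamentalDomain _, ?_, classNumberFormula K,
    integersCovolume_eq K, fun _ => ⟨finite_ramifiedPrimes, finite_characters, fun s hs =>
      ⟨fun χ => lseriesSummable_charNat χ hs, dedekindZeta_eq_correctionFactor_mul hs⟩,
      fun χ hχ m hm ω hω => isLValueAtOne_charNat hχ hm hω⟩,
    fun m _ ψ hψ ω hω => isLValueAtOne_dirichletCharacter hψ hω⟩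
  · rw [covolume_unitsImageOne]
    exact (unitsMeasure_unitsDomain K).1
  · rw [covolume_unitsImage, covolume_unitsImageOne]
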